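/- Let $\tilde Q$ be a smooth finite-dimensional manifold (Hausdorff, second countable) with a free and proper smooth left action of a Lie group $F$, with Lie algebra $\mathfrak f$ and $k=\dim\mathfrak f$, and let $F$ act on $T^*\tilde Q$ by the cotangent lift. For $\nu\in\mathfrak f$ denote by $\nu_{\tilde Q}$, $\nu_{T^*\tilde Q}$ its infinitesimal generators. Let $\tau:T^*\tilde Q\to\tilde Q$ be the projection, $\Theta$ the canonical $1$-form, $\Omega_{\tilde Q}=-d\Theta$ the canonical $2$-form on $T^*\tilde Q$, and $\tilde J:T^*\tilde Q\to\mathfrak f^*$, $\langle\tilde J(\alpha),\nu\rangle=\Theta_\alpha(\nu_{T^*\tilde Q}(\alpha))$, the canonical momentum map. Let $\tilde A:T\tilde Q\to\mathfrak f$ be a principal connection. Let $\eta_1,\dots,\eta_k:\tilde Q\to\mathfrak f$ be smooth functions such that $\eta_1(x),\dots,\eta_k(x)$ is a basis of $\mathfrak f$ for every $x\in\tilde Q$ and such that the functions $\tilde J_i(\alpha_x)=\langle\tilde J(\alpha_x),\eta_i(x)\rangle$, $\alpha_x\in T_x^*\tilde Q$, are $F$-invariant. Let $\mu^1,\dots,\mu^k:\tilde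 Q\to\mathfrak f^*$ be the dual basis, $\langle\mu^i(x),\eta_j(x)\rangle=\delta_{ij}$, and let $\tilde Y^1,\dots,\tilde Y^k$ be the $1$-forms on $\tilde Q$ with $\tilde Y^i((\eta_j)_{\tilde Q})=\delta_{ij}$ and $\tilde Y^i|_{\ker\tilde A}=0$, so that $\tilde A=\sum_i\tilde Y^i\otimes\eta_i$. For an $\mathfrak f^*$-valued function $m$ on $\tilde Q$ put $\tilde J^{-1}(m)=\{\alpha_x\in T^*\tilde Q:\tilde J(\alpha_x)=m(x)\}$. Let $c_1,\dots,c_k\in\mathbb R$ and $\mu=\sum_i c_i\mu^i$. Then the map $$\mathrm{Shift}_\mu:T^*\tilde Q\to T^*\tilde Q,\qquad \alpha_x\mapsto\alpha_x-\langle\mu(x),\tilde A_x\rangle,$$ is a diffeomorphism, and: (i) $\mathrm{Shift}_\mu^*\,\Omega_{\tilde Q}=\Omega_{\tilde Q}+\tau^*\bigl(\sum_i c_i\,d\tilde Y^i\bigr)$. (ii) $\tilde J^{-1}(\mu)$ and $\tilde J^{-1}(0)$ are $F$-invariant embedded submanifolds of $T^*\tilde Q$, and $\tilde J^{-1}(\mu)/F$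 and $\tilde J^{-1}(0)/F$ are (Hausdorff, second countable) smooth manifolds for which the orbit projections $\rho_\mu$, $\rho_0$ are submersions. $\mathrm{Shift}_\mu$ restricts to an $F$-equivariant diffeomorphism $\mathrm{shift}_\mu:\tilde J^{-1}(\mu)\to\tilde J^{-1}(0)$, and there is a diffeomorphism $\overline{\mathrm{shift}}_\mu:\tilde J^{-1}(\mu)/F\to\tilde J^{-1}(0)/F$ with $\overline{\mathrm{shift}}_\mu\circ\rho_\mu=\rho_0\circ\mathrm{shift}_\mu$. -/

import Mathlib

open scoped Manifold ContDiff Topology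
open Bundle

noncomputable section

/-! ## Differential forms on boundaryless manifolds -/

section Forms

variable {E : Type*} [NormedAddCommGroup E] [NormedSpace ℝ E]
  {H : Type*} [TopologicalSpace H] (I : ModelWithCorners ℝ E H)
  {M : Type*} [TopologicalSpace M] [ChartedSpace H M]
  {E' : Type*} [NormedAddCommGroup E'] [NormedSpace ℝ E']
  {H' : Type*} [TopologicalSpace H'] (I' : ModelWithCorners ℝ E' H')
  {M' : Type*} [TopologicalSpace M'] [ChartedSpace H' M']

variable (M) in
/-- (Not necessarily smooth) differential `n`-forms on `M`. -/
abbrev DForm (n : ℕ) : Type _ := ∀ x : M, TangentSpace I x [⋀^Fin n]→L[ℝ] ℝ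

variable {I} in
/-- A field of covectors, seen as a differential `1`-form. -/
def oneForm (θ : ∀ x : M, TangentSpace I x →L[ℝ] ℝ) : DForm I M 1 :=
  fun x => ContinuousAlternatingMap.ofSubsingleton ℝ (TangentSpace I x) ℝ (0 : Fin 1) (θ x)

variable {I I'} in
/-- The pull-back `f^* θ` of a form. -/
def pullbackForm (f : M → M') {n : ℕ} (θ : DForm I' M' n) : DForm I M n :=
  fun x => (θ (f x)).compContinuousLinearMap (mfderiv I I' f x)

variable {I} in
/-- The exterior derivative of a form on a boundaryless manifold: at `x`, write the form in the
chart `φ` at `x` (that is, pull it back by `φ⁻¹`), take the exterior derivative in the model vector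
space, and pull the result back by `φ`. -/
def dForm {n : ℕ} (θ : DForm I M n) : DForm I M (n + 1) := fun x =>
  (extDeriv (fun y : E => ((θ ((extChartAt I x).symm y)).compContinuousLinearMap
      (mfderiv 𝓘(ℝ, E) I (extChartAt I x).symm y) : E [⋀^Fin n]→L[ℝ] ℝ))
    (extChartAt I x x)).compContinuousLinearMap (mfderiv I 𝓘(ℝ, E) (extChartAt I x) x)

end Forms

/-! ## Embedded submanifolds and quotient manifolds -/

section Structures

variable {E : Type*} [NormedAddCommGroup E] [NormedSpace ℝ E]
  {H : Type*} [TopologicalSpace H] (I : ModelWithCorners ℝ E H)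
  {M : Type*} [TopologicalSpace M] [ChartedSpace H M]

/-- A smooth structure on the subset `S` (with the subspace topology) for which the inclusion is a
smooth embedding, i.e. which makes `S` an embedded submanifold of `M`. -/
structure SubmanifoldStructure (S : Set M) where
  dim : ℕ
  charted : ChartedSpace (EuclideanSpace ℝ (Fin dim)) S
  isManifold : IsManifold (𝓡 dim) ∞ S
  isSmoothEmbedding : Manifold.IsSmoothEmbedding (𝓡 dim) I ∞ (Subtype.val : S → M)

attribute [instance] SubmanifoldStructure.charted SubmanifoldStructure.isManifold

/-- A smooth structure on the quotient `M / s` (with the quotient topology, which has to be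
Hausdorff and second countable) for which the projection is a smooth submersion, i.e. which makes
`M / s` a quotient manifold of `M`. -/
structure QuotientManifoldStructure (s : Setoid M) where
  dim : ℕ
  charted : ChartedSpace (EuclideanSpace ℝ (Fin dim)) (Quotient s)
  isManifold : IsManifold (𝓡 dim) ∞ (Quotient s)
  t2Space : T2Space (Quotient s)
  secondCountable : SecondCountableTopology (Quotient s)
  isSubmersion : Manifold.IsSubmersion I (𝓡 dim) ∞ (Quotient.mk s : M → Quotient s)

attribute [instance] QuotientManifoldStructure.charted QuotientManifoldStructure.isManifold

end Structures

/-! ## The cotangent bundle -/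

section Cotangent

variable (E : Type*) [NormedAddCommGroup E] [NormedSpace ℝ E]
  (Q : Type*) [TopologicalSpace Q] [ChartedSpace E Q] [IsManifold 𝓘(ℝ, E) ∞ Q]

/-- The cotangent bundle `T^*Q`: its points are pairs `⟨x, α⟩` with `α ∈ T_x^*Q`. Topology and
charts are those of the bundle of continuous linear maps from `TQ` to the trivial line bundle. -/
abbrev Cotangent : Type _ :=
  TotalSpace (E →L[ℝ] ℝ) (fun x : Q => TangentSpace 𝓘(ℝ, E) x →L[ℝ] Bundle.Trivial Q ℝ x)

/-- The model of the manifold `T^*Q`. -/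
abbrev cotangentModel : ModelWithCorners ℝ (E × (E →L[ℝ] ℝ)) (ModelProd E (E →L[ℝ] ℝ)) :=
  𝓘(ℝ, E).prod 𝓘(ℝ, E →L[ℝ] ℝ)

variable {E Q}

/-- The projection `T^*Q → Q`. -/
def cotangentProj : Cotangent E Q → Q := fun α => α.1

/-- The canonical (Liouville) `1`-form, `Θ_α(v) = α(Tτ(v))`. -/
def liouville (α : Cotangent E Q) : TangentSpace (cotangentModel E) α →L[ℝ] ℝ :=
  ContinuousLinearMap.comp (show TangentSpace 𝓘(ℝ, E) α.1 →L[ℝ] ℝ from α.2)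
    (mfderiv (cotangentModel E) 𝓘(ℝ, E) (cotangentProj : Cotangent E Q → Q) α)

variable (E Q) in
/-- The canonical `2`-form `Ω = -dΘ`. -/
def canonicalForm : DForm (cotangentModel E) (Cotangent E Q) 2 := -dForm (oneForm liouville)

end Cotangent

/-! ## Lie group actions -/

section Action

variable {E : Type*} [NormedAddCommGroup E] [NormedSpace ℝ E]
  {Q : Type*} [TopologicalSpace Q] [ChartedSpace E Q] [IsManifold 𝓘(ℝ, E) ∞ Q]
  {V : Type*} [NormedAddCommGroup V] [NormedSpace ℝ V]
  {F : Type*} [TopologicalSpace F] [ChartedSpace V F] [Group F] [MulAction F Q]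

/-- The adjoint action `Ad_h` on the Lie algebra: the derivative at `1` of `g ↦ h g h⁻¹`. -/
def adjointAction (h : F) : GroupLieAlgebra 𝓘(ℝ, V) F →L[ℝ] GroupLieAlgebra 𝓘(ℝ, V) F :=
  (mfderiv 𝓘(ℝ, V) 𝓘(ℝ, V) (fun g : F => h * g * h⁻¹) 1 : V →L[ℝ] V)

variable (E V F) in
/-- The infinitesimal generators at `x`: `ν ↦ ν_Q(x)`, the derivative at `1` of `g ↦ g • x`. -/
def generator (x : Q) : GroupLieAlgebra 𝓘(ℝ, V) F →L[ℝ] TangentSpace 𝓘(ℝ, E) x :=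
  (mfderiv 𝓘(ℝ, V) 𝓘(ℝ, E) (fun g : F => g • x) 1 : V →L[ℝ] E)

/-- The cotangent lift of the action: `h` sends `α ∈ T_x^*Q` to `α ∘ T(h⁻¹) ∈ T_{h x}^*Q`. -/
def cotangentLift (h : F) (α : Cotangent E Q) : Cotangent E Q :=
  ⟨h • α.1, ContinuousLinearMap.comp (show E →L[ℝ] ℝ from α.2)
    (mfderiv 𝓘(ℝ, E) 𝓘(ℝ, E) (fun y : Q => h⁻¹ • y) (h • α.1) : E →L[ℝ] E)⟩

variable (V F) in
/-- The infinitesimal generators of the lifted action: `ν ↦ ν_{T^*Q}(α)`. -/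
def cotangentGenerator (α : Cotangent E Q) :
    GroupLieAlgebra 𝓘(ℝ, V) F →L[ℝ] TangentSpace (cotangentModel E) α :=
  (mfderiv 𝓘(ℝ, V) (cotangentModel E) (fun g : F => cotangentLift g α) 1 :
    V →L[ℝ] E × (E →L[ℝ] ℝ))

variable (V F) in
/-- The canonical momentum map `T^*Q → 𝔣^*`, `⟨J(α), ν⟩ = Θ_α(ν_{T^*Q}(α))`. -/
def momentumMap (α : Cotangent E Q) : GroupLieAlgebra 𝓘(ℝ, V) F →L[ℝ] ℝ :=
  (liouville α).comp (cotangentGenerator V F α)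

/-- The function `J_η(α) = ⟨J(α), η(x)⟩`, `α ∈ T_x^*Q`, of an `𝔣`-valued function `η` on `Q`. -/
def gaugeMomentum (η : Q → GroupLieAlgebra 𝓘(ℝ, V) F) (α : Cotangent E Q) : ℝ :=
  momentumMap V F α (η α.1)

/-- The level set `J⁻¹(m) = {α ∈ T_x^*Q | J(α) = m(x)}` of an `𝔣^*`-valued function `m` on `Q`. -/
def momentumLevel (m : Q → GroupLieAlgebra 𝓘(ℝ, V) F →L[ℝ] ℝ) : Set (Cotangent E Q) :=
  {α | momentumMap V F α = m α.1}

variable (E Q V F) in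
/-- A principal connection on `Q`, as a smooth equivariant `𝔣`-valued `1`-form which reproduces
infinitesimal generators. -/
structure PrincipalConnection where
  form : ∀ x : Q, TangentSpace 𝓘(ℝ, E) x →L[ℝ] GroupLieAlgebra 𝓘(ℝ, V) F
  smooth : ContMDiff 𝓘(ℝ, E) (𝓘(ℝ, E).prod 𝓘(ℝ, E →L[ℝ] V)) ∞
    (fun x : Q => (⟨x, form x⟩ : TotalSpace (E →L[ℝ] V)
      (fun x : Q => TangentSpace 𝓘(ℝ, E) x →L[ℝ] Bundle.Trivial Q V x)))
  form_generator : ∀ (x : Q) (ν : GroupLieAlgebra 𝓘(ℝ, V) F), form x (generator E V F x ν) = ν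
  equivariant : ∀ (h : F) (x : Q) (v : TangentSpace 𝓘(ℝ, E) x),
    form (h • x) (mfderiv 𝓘(ℝ, E) 𝓘(ℝ, E) (fun y : Q => h • y) x v) =
      adjointAction h (form x v)

/-- The map `α ↦ α - ⟨m(x), A_x⟩`, `α ∈ T_x^*Q`. -/
def shiftMap (A : PrincipalConnection E Q V F) (m : Q → GroupLieAlgebra 𝓘(ℝ, V) F →L[ℝ] ℝ)
    (α : Cotangent E Q) : Cotangent E Q :=
  ⟨α.1, (show TangentSpace 𝓘(ℝ, E) α.1 →L[ℝ] ℝ from α.2) - (m α.1).comp (A.form α.1)⟩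

end Action

theorem cotangent_ext {E : Type*} [NormedAddCommGroup E] [NormedSpace ℝ E]
    {Q : Type*} [TopologicalSpace Q] [ChartedSpace E Q] {x y : Q} (hxy : x = y)
    {a b : E →L[ℝ] ℝ} (hab : a = b) : (⟨x, a⟩ : Cotangent E Q) = ⟨y, b⟩ := by
  subst hxy hab
  rfl

section Orbits

variable {E : Type*} [NormedAddCommGroup E] [NormedSpace ℝ E]
  {Q : Type*} [TopologicalSpace Q] [ChartedSpace E Q]
  (V : Type*) [NormedAddCommGroup V] [NormedSpace ℝ V]
  (F : Type*) [TopologicalSpace F] [ChartedSpace V F] [Group F] [MulAction F Q]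

theorem cotangentLift_one {F : Type*} [Group F] [MulAction F Q] (α : Cotangent E Q) :
    cotangentLift (1 : F) α = α := by
  obtain ⟨x, a⟩ := α
  refine cotangent_ext (E := E) (one_smul F x) ?_
  have h : (fun y : Q => (1 : F)⁻¹ • y) = id := by
    funext y
    simp
  rw [h, mfderiv_id]
  rfl

variable {F} in
theorem cotangentLift_mul [ContMDiffSMul 𝓘(ℝ, V) 𝓘(ℝ, E) ∞ F Q] (g h : F) (α : Cotangent E Q) :
    cotangentLift (g * h) α = cotangentLift g (cotangentLift h α) := by
  obtain ⟨x, a⟩ := α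
  refine cotangent_ext (E := E) (mul_smul g h x) ?_
  have hs : ∀ (u : F) (z : Q), MDifferentiableAt 𝓘(ℝ, E) 𝓘(ℝ, E) (fun y : Q => u • y) z := by
    intro u z
    have h1 : ContMDiff 𝓘(ℝ, E) 𝓘(ℝ, E) ∞ (fun y : Q => u • y) :=
      (ContMDiffSMul.contMDiff_smul (I := 𝓘(ℝ, V)) (I' := 𝓘(ℝ, E)) (n := ∞)
        (G := F) (M := Q)).comp (contMDiff_const.prodMk contMDiff_id)
    exact (h1 z).mdifferentiableAt (by simp)
  have hc : (fun y : Q => (g * h)⁻¹ • y) = (fun y : Q => h⁻¹ • y) ∘ (fun y : Q => g⁻¹ • y) := by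
    funext y
    simp [mul_smul]
  have hd := mfderiv_comp ((g * h) • x) (hs h⁻¹ (g⁻¹ • ((g * h) • x))) (hs g⁻¹ ((g * h) • x))
  rw [← hc] at hd
  have hx : g⁻¹ • ((g * h) • x) = h • x := by simp [mul_smul]
  have hy : (g * h) • x = g • h • x := mul_smul g h x
  ext v
  change a (mfderiv 𝓘(ℝ, E) 𝓘(ℝ, E) (fun y : Q => (g * h)⁻¹ • y) ((g * h) • x) v) =
    a (mfderiv 𝓘(ℝ, E) 𝓘(ℝ, E) (fun y : Q => h⁻¹ • y) (h • x)
      (mfderiv 𝓘(ℝ, E) 𝓘(ℝ, E) (fun y : Q => g⁻¹ • y) (g • h • x) v))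
  rw [hd, hx, hy]
  rfl

/-- The relation of lying on the same `F`-orbit on a subset of `T^*Q`. -/
def orbitSetoid [ContMDiffSMul 𝓘(ℝ, V) 𝓘(ℝ, E) ∞ F Q] (S : Set (Cotangent E Q)) : Setoid S where
  r α β := ∃ h : F, cotangentLift h α.1 = β.1
  iseqv :=
    { refl := fun α => ⟨1, cotangentLift_one α.1⟩
      symm := by
        rintro α β ⟨h, hh⟩
        refine ⟨h⁻¹, ?_⟩
        rw [← hh, ← cotangentLift_mul V, inv_mul_cancel, cotangentLift_one]
      trans := by
        rintro α β γ ⟨g, hg⟩ ⟨h, hh⟩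
        refine ⟨h * g, ?_⟩
        rw [cotangentLift_mul V, hg, hh] }

end Orbits

end

/-! The shift translates each fibre by the one-form β = ⟨μ, A⟩. This form is smooth because the dual
of a smooth frame is smooth (`contMDiff_dualBasis`), and translation by -β is the inverse map.
Splitting vectors into vertical and horizontal parts gives Y^i = μ^i ∘ A. Hence β = ∑ c_i Y^i with
constant c_i, and dβ = ∑ c_i dY^i. Since the shift preserves base points and Θ is tautological, Θ
pulls back to Θ - τ^*β. Taking -d, which commutes with pull-backs (`dForm_pullbackForm`), yields
(i).

For (ii), pairing with the frame turns J = μ into the scalar equations J_i = c_i between invariant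
functions, so the level sets are invariant. On a fibre J_i(α) = α((η_i)_Q) is linear, and these
linear forms are independent because A recovers η_i from its generator. Every value is therefore
regular, and the level sets are submanifolds (`nonempty_submanifoldStructure_of_regular`). The
lifted action on them is again free and proper because it covers the action on Q, and slices for it
provide charts of the quotient (`nonempty_quotientManifoldStructure_orbitRel`).

The shift lowers each J_i by c_i, so it exchanges the two level sets. Invariance of the J_i forces
η_i(hx) = Ad_h η_i(x) (`adjointAction_frame`). Dually μ is coadjoint equivariant, so β is invariant
and the shift is equivariant. It then matches orbits with orbits, and the induced bijection is
smooth both ways because submersions have smooth local sections (`exists_diffeomorph_quotient`). -/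

noncomputable section

set_option linter.unusedSectionVars false

/-! ### Inverse function theorem on boundaryless manifolds -/

section InverseFunction

variable {E : Type*} [NormedAddCommGroup E] [NormedSpace ℝ E] [CompleteSpace E]
  {H : Type*} [TopologicalSpace H] {I : ModelWithCorners ℝ E H} [I.Boundaryless]
  {M : Type*} [TopologicalSpace M] [ChartedSpace H M] [IsManifold I ∞ M]
  {E' : Type*} [NormedAddCommGroup E'] [NormedSpace ℝ E'] [CompleteSpace E']
  {H' : Type*} [TopologicalSpace H'] {J : ModelWithCorners ℝ E' H'} [J.Boundaryless]
  {N : Type*} [TopologicalSpace N] [ChartedSpace H' N] [IsManifold J ∞ N]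

/-- The inverse function theorem in a normed space, with smoothness of the inverse. -/
theorem exists_openPartialHomeomorph_of_contDiffOn {g : E → E'} {O : Set E} (hO : IsOpen O)
    {a : E} (ha : a ∈ O) (hg : ContDiffOn ℝ ∞ g O) (hbij : Function.Bijective (fderiv ℝ g a)) :
    ∃ R : OpenPartialHomeomorph E E', a ∈ R.source ∧ R.source ⊆ O ∧ (R : E → E') = g ∧
      ContDiffOn ℝ ∞ R.symm R.target := by
  have hgat : ∀ y ∈ O, ContDiffAt ℝ ∞ g y := fun y hy => hg.contDiffAt (hO.mem_nhds hy)
  let L := ContinuousLinearEquiv.ofBijective (fderiv ℝ g a)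
    (LinearMap.ker_eq_bot.2 hbij.1) (LinearMap.range_eq_top.2 hbij.2)
  have hL : (L : E →L[ℝ] E') = fderiv ℝ g a := rfl
  have hda : HasFDerivAt g (L : E →L[ℝ] E') a := by
    rw [hL]
    exact ((hgat a ha).differentiableAt (by simp)).hasFDerivAt
  let R := (hgat a ha).toOpenPartialHomeomorph g hda (by simp)
  have hcont : ContinuousOn (fderiv ℝ g) O := hg.continuousOn_fderiv_of_isOpen hO (by simp)
  -- The inverse is smooth wherever the derivative of `g` is invertible. Invertible maps form an
  -- open set, so `R` is restricted to such points and its inverse is smooth on the whole target.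
  have hopen : IsOpen (O ∩ fderiv ℝ g ⁻¹' Set.range ((↑) : (E ≃L[ℝ] E') → E →L[ℝ] E')) :=
    hcont.isOpen_inter_preimage hO ContinuousLinearEquiv.isOpen
  refine ⟨R.restrOpen _ hopen, ⟨?_, ha, ⟨L, hL⟩⟩, fun y hy => hy.2.1, rfl, ?_⟩
  · exact (hgat a ha).mem_toOpenPartialHomeomorph_source hda (by simp)
  · intro z hz
    have hs := (R.restrOpen _ hopen).map_target hz
    obtain ⟨-, hzO, L', hL'⟩ := hs
    have h1 : HasFDerivAt g (L' : E →L[ℝ] E') ((R.restrOpen _ hopen).symm z) := by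
      rw [hL']
      exact ((hgat _ hzO).differentiableAt (by simp)).hasFDerivAt
    exact ((R.restrOpen _ hopen).contDiffAt_symm hz h1 (hgat _ hzO)).contDiffWithinAt

variable (I) in
/-- The extended chart at a point of a boundaryless manifold, as a partial homeomorphism. -/
def extChartHomeo (x : M) : OpenPartialHomeomorph M E :=
  (chartAt H x).transHomeomorph I.toHomeomorph

theorem extChartHomeo_target (x : M) : (extChartHomeo I x).target = (extChartAt I x).target := by
  rw [extChartAt_target, I.range_eq_univ, Set.inter_univ]
  rfl

theorem contMDiffOn_extChartHomeo (x : M) :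
    ContMDiffOn I 𝓘(ℝ, E) ∞ (extChartHomeo I x) (extChartHomeo I x).source :=
  contMDiffOn_extChartAt

theorem contMDiffOn_extChartHomeo_symm (x : M) :
    ContMDiffOn 𝓘(ℝ, E) I ∞ (extChartHomeo I x).symm (extChartHomeo I x).target := by
  rw [extChartHomeo_target]
  exact contMDiffOn_extChartAt_symm x

/-- A partial homeomorphism which is smooth in both directions. -/
structure IsSmoothPartial (I : ModelWithCorners ℝ E H) (J : ModelWithCorners ℝ E' H')
    (ψ : OpenPartialHomeomorph M N) : Prop where
  toFun : ContMDiffOn I J ∞ ψ ψ.source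
  invFun : ContMDiffOn J I ∞ ψ.symm ψ.target

theorem mfderiv_bijective_of_leftInverse {f : M → N} {g : N → M} {x : M} {y : N}
    (hf : MDifferentiableAt I J f x) (hg : MDifferentiableAt J I g y) (hy : f x = y)
    (hgf : ∀ᶠ z in 𝓝 x, g (f z) = z) (hfg : ∀ᶠ z in 𝓝 y, f (g z) = z) :
    Function.Bijective (mfderiv I J f x) := by
  subst hy
  have hx : g (f x) = x := hgf.self_of_nhds
  have h1 := hasMFDerivAt_unique (hg.hasMFDerivAt.comp x hf.hasMFDerivAt)
    ((hasMFDerivAt_id x).congr_of_eventuallyEq (f₁ := g ∘ f) hgf)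
  have hf' : HasMFDerivAt I J f (g (f x)) (mfderiv I J f x : E →L[ℝ] E') := by
    rw [hx]; exact hf.hasMFDerivAt
  have h2 := hasMFDerivAt_unique (hf'.comp (f x) hg.hasMFDerivAt)
    ((hasMFDerivAt_id (f x)).congr_of_eventuallyEq (f₁ := f ∘ g) hfg)
  refine ⟨Function.LeftInverse.injective (g := mfderiv J I g (f x))
    fun v => DFunLike.congr_fun h1 v, 
    Function.RightInverse.surjective (g := (mfderiv J I g (f x))) fun v => DFunLike.congr_fun h2 v⟩

/-- The inverse function theorem on boundaryless manifolds. -/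
theorem exists_isSmoothPartial_of_mfderiv_bijective {f : M → N} {U : Set M} (hU : IsOpen U)
    {p : M} (hp : p ∈ U) (hf : ContMDiffOn I J ∞ f U)
    (hbij : Function.Bijective (mfderiv I J f p)) :
    ∃ ψ : OpenPartialHomeomorph M N, p ∈ ψ.source ∧ ψ.source ⊆ U ∧ Set.EqOn ψ f ψ.source ∧
      IsSmoothPartial I J ψ := by
  let φ := extChartHomeo I p
  let χ := extChartHomeo J (f p)
  have hφp : p ∈ φ.source := mem_chart_source H p
  have hχp : f p ∈ χ.source := mem_chart_source H' (f p)
  have hUo : IsOpen (U ∩ f ⁻¹' χ.source) := hf.continuousOn.isOpen_inter_preimage hU χ.open_source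
  let O : Set E := φ.target ∩ φ.symm ⁻¹' (U ∩ f ⁻¹' χ.source)
  have hO : IsOpen O := φ.isOpen_inter_preimage_symm hUo
  have hpO : φ p ∈ O := ⟨φ.map_source hφp, by simpa [φ.left_inv hφp] using ⟨hp, hχp⟩⟩
  let g : E → E' := χ ∘ f ∘ φ.symm
  have hgM : ContMDiffOn 𝓘(ℝ, E) 𝓘(ℝ, E') ∞ g O :=
    (contMDiffOn_extChartHomeo (f p)).comp (hf.comp ((contMDiffOn_extChartHomeo_symm p).mono
      Set.inter_subset_left) fun y hy => hy.2.1) fun y hy => hy.2.2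
  have hg : ContDiffOn ℝ ∞ g O := contMDiffOn_iff_contDiffOn.1 hgM
  have hdf : MDifferentiableAt I J f p :=
    (hf.contMDiffAt (hU.mem_nhds hp)).mdifferentiableAt (by simp)
  have hdφ : MDifferentiableAt I 𝓘(ℝ, E) φ p :=
    ((contMDiffOn_extChartHomeo p).contMDiffAt (φ.open_source.mem_nhds hφp)).mdifferentiableAt
      (by simp)
  have hdφs : MDifferentiableAt 𝓘(ℝ, E) I φ.symm (φ p) :=
    ((contMDiffOn_extChartHomeo_symm p).contMDiffAt (φ.open_target.mem_nhds
      (φ.map_source hφp))).mdifferentiableAt (by simp)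
  have hdχ : MDifferentiableAt J 𝓘(ℝ, E') χ (f p) :=
    ((contMDiffOn_extChartHomeo (f p)).contMDiffAt (χ.open_source.mem_nhds hχp)).mdifferentiableAt
      (by simp)
  have hdχs : MDifferentiableAt 𝓘(ℝ, E') J χ.symm (χ (f p)) :=
    ((contMDiffOn_extChartHomeo_symm (f p)).contMDiffAt (χ.open_target.mem_nhds
      (χ.map_source hχp))).mdifferentiableAt (by simp)
  have hb1 : Function.Bijective (mfderiv 𝓘(ℝ, E) I φ.symm (φ p)) :=
    mfderiv_bijective_of_leftInverse hdφs hdφ (φ.left_inv hφp)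
      (φ.eventually_right_inverse (φ.map_source hφp)) (φ.eventually_left_inverse hφp)
  have hb2 : Function.Bijective (mfderiv J 𝓘(ℝ, E') χ (f p)) :=
    mfderiv_bijective_of_leftInverse hdχ hdχs rfl
      (χ.eventually_left_inverse hχp) (χ.eventually_right_inverse (χ.map_source hχp))
  have hgd : Function.Bijective (fderiv ℝ g (φ p)) := by
    have e1 : φ.symm (φ p) = p := φ.left_inv hφp
    have hd1 : HasMFDerivAt I J f (φ.symm (φ p)) (mfderiv I J f p : E →L[ℝ] E') := by
      rw [e1]; exact hdf.hasMFDerivAt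
    have hd2 : HasMFDerivAt J 𝓘(ℝ, E') χ ((f ∘ φ.symm) (φ p))
        (mfderiv J 𝓘(ℝ, E') χ (f p) : E' →L[ℝ] E') := by
      rw [Function.comp_apply, e1]; exact hdχ.hasMFDerivAt
    have hd := hd2.comp (φ p) (hd1.comp (φ p) hdφs.hasMFDerivAt)
    let D : E →L[ℝ] E' := (mfderiv J 𝓘(ℝ, E') χ (f p) : E' →L[ℝ] E').comp
        ((mfderiv I J f p : E →L[ℝ] E').comp (mfderiv 𝓘(ℝ, E) I φ.symm (φ p) : E →L[ℝ] E))
    have hd' : HasFDerivAt g D (φ p) := HasMFDerivAt.hasFDerivAt hd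
    rw [HasFDerivAt.fderiv hd']
    exact hb2.comp (hbij.comp hb1)
  obtain ⟨R, hpR, hRO, hRg, hRs⟩ := exists_openPartialHomeomorph_of_contDiffOn hO hpO hg hgd
  have hkey : ∀ x ∈ (φ.trans (R.trans χ.symm)).source,
      (φ.trans (R.trans χ.symm)) x = f x ∧ x ∈ U := by
    intro x hx
    have hx1 : x ∈ φ.source := by
      simp only [mfld_simps] at hx
      exact hx.1
    have hx2 : φ x ∈ O := hRO (by
      simp only [mfld_simps] at hx
      exact hx.2.1)
    have e2 : φ.symm (φ x) = x := φ.left_inv hx1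
    constructor
    · simp only [mfld_simps, hRg, g, e2]
      refine χ.left_inv ?_
      have := hx2.2.2
      rwa [e2] at this
    · have := hx2.2.1
      rwa [e2] at this
  refine ⟨φ.trans (R.trans χ.symm), ?_, fun x hx => (hkey x hx).2, fun x hx => (hkey x hx).1, ?_, ?_⟩
  · simp only [mfld_simps]
    refine ⟨hφp, hpR, ?_⟩
    rw [hRg]
    simp only [g, mfld_simps, φ.left_inv hφp]
    exact χ.map_source hχp
  · exact (hf.mono fun x hx => (hkey x hx).2).congr fun x hx => (hkey x hx).1
  · have h1 : ContMDiffOn 𝓘(ℝ, E') 𝓘(ℝ, E) ∞ R.symm R.target := contMDiffOn_iff_contDiffOn.2 hRs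
    have h2 := contMDiffOn_extChartHomeo_symm (I := I) p
    have h3 := contMDiffOn_extChartHomeo (I := J) (f p)
    refine (h2.comp (h1.comp (h3.mono ?_) ?_) ?_)
    · intro y hy
      simp only [mfld_simps] at hy
      exact hy.1.1
    · intro y hy
      simp only [mfld_simps] at hy
      exact hy.1.2
    · intro y hy
      simp only [mfld_simps] at hy
      exact hy.2

end InverseFunction

/-! ### Embedded submanifolds from slice charts -/

section SliceCharts

variable {E : Type*} [NormedAddCommGroup E] [NormedSpace ℝ E] [CompleteSpace E]
  {H : Type*} [TopologicalSpace H] {I : ModelWithCorners ℝ E H} [I.Boundaryless]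
  {M : Type*} [TopologicalSpace M] [ChartedSpace H M] [IsManifold I ∞ M]
  {B : Type*} [NormedAddCommGroup B] [NormedSpace ℝ B]
  {W : Type*} [NormedAddCommGroup W] [NormedSpace ℝ W]

/-- A partial homeomorphism smooth in both directions, followed by a linear isomorphism of the
model space, is a chart of the maximal atlas. -/
def IsSmoothPartial.chart (ψ : OpenPartialHomeomorph M B) (e : B ≃L[ℝ] E)
    (I : ModelWithCorners ℝ E H) [I.Boundaryless] : OpenPartialHomeomorph M H :=
  ψ.transHomeomorph (e.toHomeomorph.trans I.toHomeomorph.symm)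

theorem IsSmoothPartial.chart_mem_maximalAtlas {ψ : OpenPartialHomeomorph M B}
    (hψ : IsSmoothPartial I 𝓘(ℝ, B) ψ) (e : B ≃L[ℝ] E) :
    IsSmoothPartial.chart ψ e I ∈ IsManifold.maximalAtlas I ∞ M := by
  refine OpenPartialHomeomorph.mem_maximalAtlas_of_contMDiffOn _ ?_ ?_
  · have h1 : ContMDiffOn 𝓘(ℝ, E) I ∞ I.symm Set.univ :=
      I.range_eq_univ ▸ I.contMDiffOn_symm
    have h2 : ContMDiff 𝓘(ℝ, B) 𝓘(ℝ, E) ∞ e := e.contDiff.contMDiff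
    exact h1.comp (h2.comp_contMDiffOn hψ.toFun) fun _ _ => Set.mem_univ _
  · have h2 : ContMDiff 𝓘(ℝ, E) 𝓘(ℝ, B) ∞ e.symm := e.symm.contDiff.contMDiff
    refine hψ.invFun.comp (h2.comp_contMDiffOn (I.contMDiff.contMDiffOn)) ?_
    intro y hy
    exact hy

/-- The chart of a subset `S` induced by a slice chart `ψ`, i.e. a chart of the ambient manifold
in which `S` is given by the vanishing of the second component. -/
def sliceChart {S : Set M} (ψ : OpenPartialHomeomorph M (B × W))
    (hS : ∀ x ∈ ψ.source, x ∈ S ↔ (ψ x).2 = 0) (p : S) : OpenPartialHomeomorph S B where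
  toFun x := (ψ x).1
  -- Off the target the inverse still needs some value in `S`; the point `p` serves only for that.
  invFun y := open Classical in if hy : (y, (0 : W)) ∈ ψ.target then
    ⟨ψ.symm (y, 0), (hS _ (ψ.map_target hy)).2 (by rw [ψ.right_inv hy])⟩ else p
  source := {x | (x : M) ∈ ψ.source}
  target := {y | (y, (0 : W)) ∈ ψ.target}
  map_source' x hx := by
    have h := (hS x hx).1 x.2
    have h2 := ψ.map_source hx
    rwa [show ψ x = ((ψ x).1, 0) from Prod.ext rfl h] at h2
  map_target' y hy := by
    simp only [Set.mem_ofPred_eq] at hy ⊢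
    rw [dif_pos hy]
    exact ψ.map_target hy
  left_inv' x hx := by
    have h := (hS x hx).1 x.2
    have h2 := ψ.map_source hx
    have h3 : ((ψ x).1, (0 : W)) = ψ x := Prod.ext rfl h.symm
    rw [← h3] at h2
    rw [dif_pos h2]
    refine Subtype.ext ?_
    simp only [h3]
    exact ψ.left_inv hx
  right_inv' y hy := by
    simp only [Set.mem_ofPred_eq] at hy
    rw [dif_pos hy]
    simp only [ψ.right_inv hy]
  open_source := ψ.open_source.preimage continuous_subtype_val
  open_target := ψ.open_target.preimage (by fun_prop)
  continuousOn_toFun := continuous_fst.comp_continuousOn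
    (ψ.continuousOn.comp continuous_subtype_val.continuousOn fun _ hx => hx)
  continuousOn_invFun := by
    rw [Topology.IsInducing.subtypeVal.continuousOn_iff]
    have h : ContinuousOn (fun y : B => ψ.symm (y, (0 : W))) {y | (y, (0 : W)) ∈ ψ.target} :=
      ψ.continuousOn_symm.comp (by fun_prop) fun _ hy => hy
    refine h.congr fun y hy => ?_
    simp only [Set.mem_ofPred_eq] at hy
    simp only [Function.comp_apply, dif_pos hy]

theorem sliceChart_symm_coe {S : Set M} {ψ : OpenPartialHomeomorph M (B × W)}
    (hS : ∀ x ∈ ψ.source, x ∈ S ↔ (ψ x).2 = 0) (p : S) {y : B} (hy : (y, (0 : W)) ∈ ψ.target) :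
    (((sliceChart ψ hS p).symm y : S) : M) = ψ.symm (y, 0) := by
  rw [show (sliceChart ψ hS p).symm y = _ from dif_pos hy]

/-- A subset which is given by a slice chart at each of its points is an embedded submanifold. -/
theorem nonempty_submanifoldStructure_of_slices {d : ℕ} {S : Set M}
    (h : ∀ p : S, ∃ ψ : OpenPartialHomeomorph M (EuclideanSpace ℝ (Fin d) × W),
      (p : M) ∈ ψ.source ∧ IsSmoothPartial I 𝓘(ℝ, EuclideanSpace ℝ (Fin d) × W) ψ ∧
        ∀ x ∈ ψ.source, x ∈ S ↔ (ψ x).2 = 0)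
    (e : S → ((EuclideanSpace ℝ (Fin d) × W) ≃L[ℝ] E)) :
    Nonempty (SubmanifoldStructure I S) := by
  choose ψ hp hψ hS using h
  let χ : S → OpenPartialHomeomorph S (EuclideanSpace ℝ (Fin d)) := fun p =>
    sliceChart (ψ p) (hS p) p
  let cs : ChartedSpace (EuclideanSpace ℝ (Fin d)) S :=
    { atlas := Set.range χ
      chartAt := χ
      mem_chart_source := hp
      chart_mem_atlas := fun p => ⟨p, rfl⟩ }
  have hman : IsManifold (𝓡 d) ∞ S := by
    refine isManifold_of_contDiffOn _ _ _ ?_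
    rintro _ _ ⟨p, rfl⟩ ⟨q, rfl⟩
    have h1 : ContMDiffOn 𝓘(ℝ, EuclideanSpace ℝ (Fin d)) 𝓘(ℝ, EuclideanSpace ℝ (Fin d)) ∞
        (fun y => (ψ q ((ψ p).symm (y, 0))).1)
        {y | (y, (0 : W)) ∈ (ψ p).target ∧ (ψ p).symm (y, 0) ∈ (ψ q).source} := by
      have i1 : ContMDiff 𝓘(ℝ, EuclideanSpace ℝ (Fin d)) 𝓘(ℝ, EuclideanSpace ℝ (Fin d) × W) ∞
          (fun y => (y, (0 : W))) := (contDiff_id.prodMk contDiff_const).contMDiff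
      have i2 : ContMDiff 𝓘(ℝ, EuclideanSpace ℝ (Fin d) × W) 𝓘(ℝ, EuclideanSpace ℝ (Fin d)) ∞
          (Prod.fst : EuclideanSpace ℝ (Fin d) × W → _) := contDiff_fst.contMDiff
      exact i2.comp_contMDiffOn ((hψ q).toFun.comp ((hψ p).invFun.comp
        i1.contMDiffOn fun y hy => hy.1) fun y hy => hy.2)
    have key : ∀ y ∈ ((χ p).symm ≫ₕ χ q).source, (y, (0 : W)) ∈ (ψ p).target ∧
        (((χ p).symm y : S) : M) = (ψ p).symm (y, 0) ∧ (ψ p).symm (y, 0) ∈ (ψ q).source := by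
      intro y hy
      have hy1 : (y, (0 : W)) ∈ (ψ p).target := hy.1
      have e1 : (((χ p).symm y : S) : M) = (ψ p).symm (y, 0) := sliceChart_symm_coe _ p hy1
      have hy2 : (((χ p).symm y : S) : M) ∈ (ψ q).source := hy.2
      exact ⟨hy1, e1, e1 ▸ hy2⟩
    have h2 := contMDiffOn_iff_contDiffOn.1 h1
    refine (h2.mono fun y hy => ?_).congr fun y hy => ?_
    · have := key y hy.1
      exact ⟨this.1, this.2.2⟩
    · have := key y hy.1
      change (ψ q (((χ p).symm y : S) : M)).1 = _
      rw [this.2.1]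
  refine ⟨⟨d, cs, hman, ⟨Manifold.IsImmersionOfComplement.isImmersion (F := W) fun p => ?_,
    Topology.IsEmbedding.subtypeVal⟩⟩⟩
  -- In the induced chart and the slice chart the inclusion reads y ↦ (y, 0), the normal form of an
  -- immersion with complement `W`.
  refine Manifold.IsImmersionAtOfComplement.mk_of_charts (e p) (χ p)
    (IsSmoothPartial.chart (ψ p) (e p) I) (hp p) (hp p)
    (IsManifold.chart_mem_maximalAtlas p) ((hψ p).chart_mem_maximalAtlas (e p)) ?_ ?_
  · intro x hx
    exact hx
  · intro y hy
    have hy1 : (y, (0 : W)) ∈ (ψ p).target := by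
      have : y ∈ (χ p).target := by simpa using hy
      exact this
    have e1 : (((χ p).symm y : S) : M) = (ψ p).symm (y, 0) := sliceChart_symm_coe _ p hy1
    change I (I.symm (e p (ψ p (((χ p).symm y : S) : M)))) = e p (y, 0)
    rw [e1, (ψ p).right_inv hy1, I.right_inv (I.range_eq_univ ▸ Set.mem_univ _)]

end SliceCharts

/-! ### Regular level sets -/

section LevelSets

/-- A surjective linear map is the second component of a linear isomorphism. -/
theorem exists_bijective_prod_of_surjective {E W : Type*} [NormedAddCommGroup E] [NormedSpace ℝ E]
    [FiniteDimensional ℝ E] [NormedAddCommGroup W] [NormedSpace ℝ W] [FiniteDimensional ℝ W]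
    (D : E →L[ℝ] W) (hD : Function.Surjective D) :
    ∃ P : E →L[ℝ] EuclideanSpace ℝ (Fin (Module.finrank ℝ E - Module.finrank ℝ W)),
      Function.Bijective (P.prod D) := by
  let K := LinearMap.ker (D : E →ₗ[ℝ] W)
  have hrk := LinearMap.finrank_range_add_finrank_ker (D : E →ₗ[ℝ] W)
  rw [(LinearMap.range_eq_top.2 hD : LinearMap.range (D : E →ₗ[ℝ] W) = ⊤), finrank_top] at hrk
  have hK : Module.finrank ℝ K = Module.finrank ℝ
      (EuclideanSpace ℝ (Fin (Module.finrank ℝ E - Module.finrank ℝ W))) := by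
    rw [finrank_euclideanSpace_fin]
    change Module.finrank ℝ (LinearMap.ker (D : E →ₗ[ℝ] W)) = _
    omega
  obtain ⟨C, hC⟩ := Submodule.exists_isCompl K
  -- Projection onto the kernel of `D` along a complement, in coordinates. A vector killed by both
  -- `P` and `D` is zero, and the dimensions agree.
  let P : E →ₗ[ℝ] EuclideanSpace ℝ (Fin (Module.finrank ℝ E - Module.finrank ℝ W)) :=
    (LinearEquiv.ofFinrankEq _ _ hK).toLinearMap ∘ₗ K.projectionOnto C hC
  have hinj : Function.Injective (P.prod (D : E →ₗ[ℝ] W)) := by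
    rw [injective_iff_map_eq_zero]
    intro x hx
    have h1 : P x = 0 := congrArg Prod.fst hx
    have h2 : D x = 0 := congrArg Prod.snd hx
    have hxK : x ∈ K := h2
    have h3 : K.projectionOnto C hC x = 0 := by
      simpa [P] using h1
    have h4 := Submodule.projectionOnto_apply_left hC ⟨x, hxK⟩
    rw [h3] at h4
    exact (congrArg Subtype.val h4).symm
  refine ⟨LinearMap.toContinuousLinearMap P, ?_⟩
  have hfr : Module.finrank ℝ E = Module.finrank ℝ
      (EuclideanSpace ℝ (Fin (Module.finrank ℝ E - Module.finrank ℝ W)) × W) := by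
    rw [Module.finrank_prod, ← hK]
    change _ = Module.finrank ℝ (LinearMap.ker (D : E →ₗ[ℝ] W)) + _
    omega
  exact ⟨hinj, (LinearMap.injective_iff_surjective_of_finrank_eq_finrank hfr).1 hinj⟩

/-- The space B × W carries its own model `𝓘(ℝ, B × W)` here, not the product of the models of the
factors; this is the form in which the inverse function theorem is applied to level sets. -/
theorem hasMFDerivAt_prodMk_space {E : Type*} [NormedAddCommGroup E] [NormedSpace ℝ E]
    {H : Type*} [TopologicalSpace H] {I : ModelWithCorners ℝ E H}
    {M : Type*} [TopologicalSpace M] [ChartedSpace H M]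
    {B : Type*} [NormedAddCommGroup B] [NormedSpace ℝ B]
    {W : Type*} [NormedAddCommGroup W] [NormedSpace ℝ W]
    {f : M → B} {g : M → W} {x : M} {f' : E →L[ℝ] B} {g' : E →L[ℝ] W}
    (hf : HasMFDerivAt I 𝓘(ℝ, B) f x f') (hg : HasMFDerivAt I 𝓘(ℝ, W) g x g') :
    HasMFDerivAt I 𝓘(ℝ, B × W) (fun y => (f y, g y)) x (f'.prod g') :=
  ⟨hf.1.prodMk hg.1, hf.2.prodMk hg.2⟩

variable {E : Type*} [NormedAddCommGroup E] [NormedSpace ℝ E] [FiniteDimensional ℝ E]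
  {H : Type*} [TopologicalSpace H] {I : ModelWithCorners ℝ E H} [I.Boundaryless]
  {M : Type*} [TopologicalSpace M] [ChartedSpace H M] [IsManifold I ∞ M]
  {W : Type*} [NormedAddCommGroup W] [NormedSpace ℝ W] [FiniteDimensional ℝ W]

/-- The regular level set theorem. -/
theorem nonempty_submanifoldStructure_of_regular {G : M → W} (hG : ContMDiff I 𝓘(ℝ, W) ∞ G)
    (hreg : ∀ p, G p = 0 → Function.Surjective (mfderiv I 𝓘(ℝ, W) G p)) :
    Nonempty (SubmanifoldStructure I {p | G p = 0}) := by
  have : CompleteSpace E := FiniteDimensional.complete ℝ E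
  have : CompleteSpace W := FiniteDimensional.complete ℝ W
  have hP : ∀ p, G p = 0 → ∃ P : E →L[ℝ] EuclideanSpace ℝ
      (Fin (Module.finrank ℝ E - Module.finrank ℝ W)),
      Function.Bijective (P.prod (mfderiv I 𝓘(ℝ, W) G p : E →L[ℝ] W)) := fun p hp =>
    exists_bijective_prod_of_surjective _ (hreg p hp)
  choose! P hPb using hP
  refine nonempty_submanifoldStructure_of_slices (W := W)
    (d := Module.finrank ℝ E - Module.finrank ℝ W) ?_ ?_
  · rintro ⟨p, hp⟩
    let D : E →L[ℝ] W := mfderiv I 𝓘(ℝ, W) G p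
    let f : M → EuclideanSpace ℝ (Fin (Module.finrank ℝ E - Module.finrank ℝ W)) × W :=
      fun x => (P p (extChartAt I p x), G x)
    have hf1 : ContMDiffOn I 𝓘(ℝ, EuclideanSpace ℝ (Fin (Module.finrank ℝ E -
        Module.finrank ℝ W))) ∞ (fun x => P p (extChartAt I p x)) (chartAt H p).source :=
      (P p).contMDiff.comp_contMDiffOn contMDiffOn_extChartAt
    have hf : ContMDiffOn I 𝓘(ℝ, EuclideanSpace ℝ (Fin (Module.finrank ℝ E -
        Module.finrank ℝ W)) × W) ∞ f (chartAt H p).source :=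
      hf1.prodMk_space hG.contMDiffOn
    -- Tangent vectors at `p` are expressed in the chart at `p`, so this chart has the identity as
    -- derivative there and the derivative of `f` is (P, dG).
    have hd1 : HasMFDerivAt I 𝓘(ℝ, E) (extChartAt I p) p (ContinuousLinearMap.id ℝ E) := by
      have := (mdifferentiableAt_extChartAt (I := I) (mem_chart_source H p)).hasMFDerivAt
      rwa [mfderiv_extChartAt_self] at this
    have hd2 : HasMFDerivAt I 𝓘(ℝ, EuclideanSpace ℝ (Fin (Module.finrank ℝ E -
        Module.finrank ℝ W))) (fun x => P p (extChartAt I p x)) p (P p) :=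
      ((P p).hasMFDerivAt (x := extChartAt I p p)).comp p hd1
    have hd3 : HasMFDerivAt I 𝓘(ℝ, EuclideanSpace ℝ (Fin (Module.finrank ℝ E -
        Module.finrank ℝ W)) × W) f p ((P p).prod D) :=
      hasMFDerivAt_prodMk_space hd2 ((hG p).mdifferentiableAt (by simp)).hasMFDerivAt
    obtain ⟨ψ, h1, h2, h3, h4⟩ := exists_isSmoothPartial_of_mfderiv_bijective
      (chartAt H p).open_source (mem_chart_source H p) hf
      (by rw [hd3.mfderiv]; exact hPb p hp)
    refine ⟨ψ, h1, h4, fun x hx => ?_⟩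
    rw [h3 hx]
    rfl
  -- The isomorphism is made from a point of the level set. With truncated subtraction in the
  -- dimension, none need exist when the level set is empty.
  · intro p
    exact (ContinuousLinearEquiv.ofBijective _ (LinearMap.ker_eq_bot.2 (hPb p p.2).1)
      (LinearMap.range_eq_top.2 (hPb p p.2).2)).symm

end LevelSets

/-! ### Quotient manifolds from adapted charts -/

section QuotientCharts

variable {E : Type*} [NormedAddCommGroup E] [NormedSpace ℝ E] [CompleteSpace E]
  {H : Type*} [TopologicalSpace H] {I : ModelWithCorners ℝ E H} [I.Boundaryless]
  {M : Type*} [TopologicalSpace M] [ChartedSpace H M] [IsManifold I ∞ M]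
  {B : Type*} [NormedAddCommGroup B] [NormedSpace ℝ B]
  {W : Type*} [NormedAddCommGroup W] [NormedSpace ℝ W]

/-- A chart of `M` in which the classes of `s` are the fibres of the first component, and whose
target contains the slice through the second component of the image of `p`. -/
structure IsAdapted (s : Setoid M) (ψ : OpenPartialHomeomorph M (B × W)) (p : M) : Prop where
  rel_iff : ∀ x ∈ ψ.source, ∀ y ∈ ψ.source, s x y ↔ (ψ x).1 = (ψ y).1
  slice_mem : ∀ z ∈ ψ.target, (z.1, (ψ p).2) ∈ ψ.target

open Classical in
/-- The map induced on the quotient by the first component of an adapted chart. -/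
def adaptedFun (s : Setoid M) (ψ : OpenPartialHomeomorph M (B × W)) (q : Quotient s) : B :=
  if h : ∃ x ∈ ψ.source, Quotient.mk s x = q then (ψ h.choose).1 else 0

/-- Independence of the chosen representative: by `rel_iff`, equivalent points of the source have
the same first component. The point `y` itself may lie outside the source. -/
theorem adaptedFun_mk {s : Setoid M} {ψ : OpenPartialHomeomorph M (B × W)} {p : M}
    (h : IsAdapted s ψ p) {x y : M} (hx : x ∈ ψ.source) (hxy : Quotient.mk s x = Quotient.mk s y) :
    adaptedFun s ψ (Quotient.mk s y) = (ψ x).1 := by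
  have hex : ∃ x ∈ ψ.source, Quotient.mk s x = Quotient.mk s y := ⟨x, hx, hxy⟩
  rw [adaptedFun, dif_pos hex]
  exact (h.rel_iff _ hex.choose_spec.1 _ hx).1 (Quotient.exact (hex.choose_spec.2.trans hxy.symm))

/-- The chart of the quotient induced by an adapted chart. -/
def adaptedChart (s : Setoid M) (hs : IsOpenMap (Quotient.mk s))
    (ψ : OpenPartialHomeomorph M (B × W)) (p : M) (h : IsAdapted s ψ p) :
    OpenPartialHomeomorph (Quotient s) B where
  toFun := adaptedFun s ψ
  -- The inverse runs through the slice at the height of `p`; `slice_mem` ensures that this slice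
  -- meets every class in the source.
  invFun y := Quotient.mk s (ψ.symm (y, (ψ p).2))
  source := Quotient.mk s '' ψ.source
  target := {y | (y, (ψ p).2) ∈ ψ.target}
  map_source' := by
    rintro _ ⟨x, hx, rfl⟩
    rw [adaptedFun_mk h hx rfl]
    exact h.slice_mem _ (ψ.map_source hx)
  map_target' y hy := ⟨_, ψ.map_target hy, rfl⟩
  left_inv' := by
    rintro _ ⟨x, hx, rfl⟩
    rw [adaptedFun_mk h hx rfl]
    have hm := h.slice_mem _ (ψ.map_source hx)
    refine Quotient.sound ((h.rel_iff _ (ψ.map_target hm) _ hx).2 ?_)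
    rw [ψ.right_inv hm]
  right_inv' y hy := by
    rw [adaptedFun_mk h (ψ.map_target hy) rfl, ψ.right_inv hy]
  open_source := hs _ ψ.open_source
  open_target := ψ.open_target.preimage (by fun_prop)
  continuousOn_toFun := by
    rintro _ ⟨x, hx, rfl⟩
    refine ContinuousAt.continuousWithinAt ?_
    have h1 : Filter.Tendsto (adaptedFun s ψ ∘ Quotient.mk s) (𝓝 x)
        (𝓝 (adaptedFun s ψ (Quotient.mk s x))) := by
      rw [adaptedFun_mk h hx rfl]
      refine (continuous_fst.continuousAt.tendsto.comp (ψ.continuousAt hx)).congr' ?_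
      filter_upwards [ψ.open_source.mem_nhds hx] with y hy
      exact (adaptedFun_mk h hy rfl).symm
    exact (Filter.tendsto_map'_iff.2 h1).mono_left (hs.nhds_le x)
  continuousOn_invFun := continuous_quotient_mk'.comp_continuousOn
    (ψ.continuousOn_symm.comp (by fun_prop) fun _ hy => hy)

/-- A quotient with adapted charts at each point, such that equivalent points are related by a
smooth map which preserves the classes, is a quotient manifold. -/
theorem nonempty_quotientManifoldStructure_of_adapted {d : ℕ} [SecondCountableTopology M]
    {s : Setoid M} [T2Space (Quotient s)] (hs : IsOpenMap (Quotient.mk s))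
    (h : ∀ p : M, ∃ ψ : OpenPartialHomeomorph M (EuclideanSpace ℝ (Fin d) × W),
      p ∈ ψ.source ∧ IsSmoothPartial I 𝓘(ℝ, EuclideanSpace ℝ (Fin d) × W) ψ ∧ IsAdapted s ψ p)
    (hhom : ∀ x y, s x y → ∃ f : M → M, ContMDiff I I ∞ f ∧ f x = y ∧ ∀ z, s z (f z))
    (e : M → ((EuclideanSpace ℝ (Fin d) × W) ≃L[ℝ] E)) :
    Nonempty (QuotientManifoldStructure I s) := by
  choose ψ hp hψ hA using h
  let χ : M → OpenPartialHomeomorph (Quotient s) (EuclideanSpace ℝ (Fin d)) := fun p =>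
    adaptedChart s hs (ψ p) p (hA p)
  let cs : ChartedSpace (EuclideanSpace ℝ (Fin d)) (Quotient s) :=
    { atlas := Set.range χ
      chartAt := fun q => χ q.out
      mem_chart_source := fun q => ⟨q.out, hp _, Quotient.out_eq q⟩
      chart_mem_atlas := fun q => ⟨q.out, rfl⟩ }
  have hman : IsManifold (𝓡 d) ∞ (Quotient s) := by
    refine isManifold_of_contDiffOn _ _ _ ?_
    rintro _ _ ⟨p, rfl⟩ ⟨q, rfl⟩
    rintro y ⟨⟨hy1, x1, hx1, hx01⟩, -⟩
    refine ContDiffAt.contDiffWithinAt ?_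
    change (y, (ψ p p).2) ∈ (ψ p).target at hy1
    change Quotient.mk s x1 = Quotient.mk s ((ψ p).symm (y, (ψ p p).2)) at hx01
    -- A class in both chart domains may have different representatives in the two sources. A
    -- class-preserving smooth map carries one to the other, so near `y` the transition is the first
    -- component of a smooth map.
    obtain ⟨f, hf, hfx, hfs⟩ := hhom _ _ (Quotient.exact hx01.symm)
    have i1 : ContMDiff 𝓘(ℝ, EuclideanSpace ℝ (Fin d)) 𝓘(ℝ, EuclideanSpace ℝ (Fin d) × W) ∞
        (fun y => (y, (ψ p p).2)) := (contDiff_id.prodMk contDiff_const).contMDiff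
    have i2 : ContMDiff 𝓘(ℝ, EuclideanSpace ℝ (Fin d) × W) 𝓘(ℝ, EuclideanSpace ℝ (Fin d)) ∞
        (Prod.fst : EuclideanSpace ℝ (Fin d) × W → _) := contDiff_fst.contMDiff
    have i3 : ContMDiffAt 𝓘(ℝ, EuclideanSpace ℝ (Fin d)) I ∞
        (fun y => f ((ψ p).symm (y, (ψ p p).2))) y :=
      (hf _).comp y (((hψ p).invFun.contMDiffAt ((ψ p).open_target.mem_nhds hy1)).comp y (i1 y))
    have hmem : f ((ψ p).symm (y, (ψ p p).2)) ∈ (ψ q).source := by rwa [hfx]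
    have i4 : ContMDiffAt 𝓘(ℝ, EuclideanSpace ℝ (Fin d)) 𝓘(ℝ, EuclideanSpace ℝ (Fin d)) ∞
        (fun y => (ψ q (f ((ψ p).symm (y, (ψ p p).2)))).1) y :=
      (i2 _).comp y (((hψ q).toFun.contMDiffAt ((ψ q).open_source.mem_nhds hmem)).comp y i3)
    refine (contMDiffAt_iff_contDiffAt.1 i4).congr_of_eventuallyEq ?_
    filter_upwards [i3.continuousAt.preimage_mem_nhds ((ψ q).open_source.mem_nhds hmem)]
      with z hz
    exact adaptedFun_mk (hA q) hz (Quotient.sound (Setoid.symm (hfs _)))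
  have hsc : SecondCountableTopology (Quotient s) :=
    (isQuotientMap_quotient_mk' (s := s)).secondCountableTopology hs
  refine ⟨⟨d, cs, hman, inferInstance, hsc,
    Manifold.IsSubmersionOfComplement.isSubmersion (F := W) fun p => ?_⟩⟩
  -- In these charts the quotient map is the first projection, the normal form of a submersion.
  refine Manifold.IsSubmersionAtOfComplement.mk_of_charts (e p).symm
    (IsSmoothPartial.chart (ψ p) (e p) I) (χ p) (hp p) ⟨p, hp p, rfl⟩
    ((hψ p).chart_mem_maximalAtlas (e p))
    (IsManifold.subset_maximalAtlas ⟨p, rfl⟩) (fun x hx => ⟨x, hx, rfl⟩) ?_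
  intro y hy
  have hy2 : (e p).symm (I (I.symm y)) ∈ (ψ p).target := by
    have := hy.2
    exact this
  rw [I.right_inv (I.range_eq_univ ▸ Set.mem_univ _)] at hy2
  change adaptedFun s (ψ p) (Quotient.mk s ((ψ p).symm ((e p).symm (I (I.symm y))))) =
    ((e p).symm y).1
  rw [I.right_inv (I.range_eq_univ ▸ Set.mem_univ _),
    adaptedFun_mk (hA p) ((ψ p).map_target hy2) rfl, (ψ p).right_inv hy2]

end QuotientCharts

/-! ### Quotients by free proper actions -/

section Actions

/-- An injective linear map is the first component of a linear isomorphism. -/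
theorem exists_bijective_coprod_of_injective {E V : Type*} [NormedAddCommGroup E]
    [NormedSpace ℝ E] [FiniteDimensional ℝ E] [NormedAddCommGroup V] [NormedSpace ℝ V]
    (D : V →L[ℝ] E) (hD : Function.Injective D) :
    ∃ ι : EuclideanSpace ℝ (Fin (Module.finrank ℝ E - Module.finrank ℝ V)) →L[ℝ] E,
      Function.Bijective (D.coprod ι) := by
  let R := LinearMap.range (D : V →ₗ[ℝ] E)
  obtain ⟨C, hC⟩ := Submodule.exists_isCompl R
  have hR : Module.finrank ℝ R = Module.finrank ℝ V :=
    LinearMap.finrank_range_of_inj (f := (D : V →ₗ[ℝ] E)) hD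
  have hRC := Submodule.finrank_add_eq_of_isCompl hC
  have hCd : Module.finrank ℝ (EuclideanSpace ℝ
      (Fin (Module.finrank ℝ E - Module.finrank ℝ V))) = Module.finrank ℝ C := by
    rw [finrank_euclideanSpace_fin]
    omega
  let ε := LinearEquiv.ofFinrankEq _ _ hCd
  refine ⟨LinearMap.toContinuousLinearMap (C.subtype ∘ₗ ε.toLinearMap), ?_, ?_⟩
  · rw [injective_iff_map_eq_zero]
    rintro ⟨v, y⟩ h
    have h1 : D v + (ε y : E) = 0 := h
    have h2 : D v = -(ε y : E) := eq_neg_of_add_eq_zero_left h1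
    have h3 : D v ∈ R ⊓ C := ⟨⟨v, rfl⟩, by rw [h2]; exact C.neg_mem (ε y).2⟩
    rw [hC.inf_eq_bot, Submodule.mem_bot] at h3
    rw [h3, zero_add] at h1
    have h4 : y = 0 := ε.map_eq_zero_iff.1 (Subtype.ext h1)
    rw [h4, hD (h3.trans (map_zero D).symm)]
    rfl
  · intro x
    obtain ⟨r, hr, c, hc, rfl⟩ := Submodule.mem_sup.1 (hC.sup_eq_top.ge (Submodule.mem_top (x := x)))
    obtain ⟨v, rfl⟩ := hr
    refine ⟨(v, ε.symm ⟨c, hc⟩), ?_⟩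
    change D v + (ε (ε.symm ⟨c, hc⟩) : E) = D v + c
    rw [ε.apply_symm_apply]

/-- For a free proper action, group elements which move a point close to `p` to a point close
to `p` are close to `1`. -/
theorem exists_nhds_smul_mem {F M : Type*} [TopologicalSpace F] [Group F] [TopologicalSpace M]
    [MulAction F M] [ProperSMul F M] (hfree : ∀ (h : F) (x : M), h • x = x → h = 1)
    (p : M) {W : Set F} (hW : IsOpen W) (h1 : (1 : F) ∈ W) :
    ∃ N : Set M, IsOpen N ∧ p ∈ N ∧ ∀ (g : F) (x : M), x ∈ N → g • x ∈ N → g ∈ W := by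
  let f : F × M → M × M := fun gx => (gx.1 • gx.2, gx.2)
  -- Properness makes the set of pairs (g • x, x) with g outside `W` closed; freeness keeps (p, p)
  -- out of it. A product neighbourhood of (p, p) missing this set gives `N`.
  have hcl : IsClosed (f '' (W ×ˢ (Set.univ : Set M))ᶜ) :=
    (ProperSMul.isProperMap_smul_pair (G := F) (X := M)).isClosedMap _
      (hW.prod isOpen_univ).isClosed_compl
  have hp : (p, p) ∈ (f '' (W ×ˢ (Set.univ : Set M))ᶜ)ᶜ := by
    rintro ⟨⟨g, x⟩, hgx, he⟩
    have e1 : g • x = p := congrArg Prod.fst he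
    have e2 : x = p := congrArg Prod.snd he
    rw [e2] at e1
    exact hgx ⟨hfree g p e1 ▸ h1, Set.mem_univ _⟩
  obtain ⟨u, v, hu, hv, hpu, hpv, huv⟩ := isOpen_prod_iff.1 hcl.isOpen_compl p p hp
  refine ⟨u ∩ v, hu.inter hv, ⟨hpu, hpv⟩, fun g x hx hgx => ?_⟩
  by_contra hg
  exact huv ⟨hgx.1, hx.2⟩ ⟨(g, x), fun h => hg h.1, rfl⟩

variable {E : Type*} [NormedAddCommGroup E] [NormedSpace ℝ E] [FiniteDimensional ℝ E]
  {M : Type*} [TopologicalSpace M] [ChartedSpace E M] [IsManifold 𝓘(ℝ, E) ∞ M]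
  {V : Type*} [NormedAddCommGroup V] [NormedSpace ℝ V] [FiniteDimensional ℝ V]
  {F : Type*} [TopologicalSpace F] [ChartedSpace V F] [Group F] [LieGroup 𝓘(ℝ, V) ∞ F]
  [MulAction F M] [ContMDiffSMul 𝓘(ℝ, V) 𝓘(ℝ, E) ∞ F M] [ProperSMul F M]

/-- Take for σ an affine slice in the chart at `p`, directed by a complement of the tangent space of
the orbit. The derivative of (g, s) ↦ g • σ(s) at (1, 0) is then bijective, and the inverse function
theorem gives θ. -/
theorem exists_smul_slice (p : M)
    (hgen : Function.Injective (mfderiv 𝓘(ℝ, V) 𝓘(ℝ, E) (fun g : F => g • p) 1)) :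
    ∃ (σ : EuclideanSpace ℝ (Fin (Module.finrank ℝ E - Module.finrank ℝ V)) → M)
      (θ : OpenPartialHomeomorph
        (F × EuclideanSpace ℝ (Fin (Module.finrank ℝ E - Module.finrank ℝ V))) M),
      σ 0 = p ∧ (1, 0) ∈ θ.source ∧ (∀ z ∈ θ.source, θ z = z.1 • σ z.2) ∧
      (∃ O, IsOpen O ∧ 0 ∈ O ∧ ContinuousOn σ O) ∧
      IsSmoothPartial (𝓘(ℝ, V).prod 𝓘(ℝ, EuclideanSpace ℝ
        (Fin (Module.finrank ℝ E - Module.finrank ℝ V)))) 𝓘(ℝ, E) θ := by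
  have : CompleteSpace E := FiniteDimensional.complete ℝ E
  have : CompleteSpace V := FiniteDimensional.complete ℝ V
  let D : V →L[ℝ] E := mfderiv 𝓘(ℝ, V) 𝓘(ℝ, E) (fun g : F => g • p) 1
  obtain ⟨ι, hι⟩ := exists_bijective_coprod_of_injective D hgen
  let d := Module.finrank ℝ E - Module.finrank ℝ V
  let φ := extChartHomeo 𝓘(ℝ, E) p
  have hφp : p ∈ φ.source := mem_chart_source E p
  let σ : EuclideanSpace ℝ (Fin d) → M := fun s => φ.symm (φ p + ι s)
  let O : Set (EuclideanSpace ℝ (Fin d)) := {s | φ p + ι s ∈ φ.target}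
  have hO : IsOpen O := φ.open_target.preimage (by fun_prop)
  have h0O : (0 : EuclideanSpace ℝ (Fin d)) ∈ O := by
    simpa [O] using φ.map_source hφp
  have hσ0 : σ 0 = p := by simp [σ, φ.left_inv hφp]
  have hι' : ContMDiff 𝓘(ℝ, EuclideanSpace ℝ (Fin d)) 𝓘(ℝ, E) ∞ (fun s => φ p + ι s) :=
    (contDiff_const.add ι.contDiff).contMDiff
  have hσ : ContMDiffOn 𝓘(ℝ, EuclideanSpace ℝ (Fin d)) 𝓘(ℝ, E) ∞ σ O :=
    (contMDiffOn_extChartHomeo_symm p).comp hι'.contMDiffOn fun s hs => hs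
  let f : F × EuclideanSpace ℝ (Fin d) → M := fun z => z.1 • σ z.2
  have hU : IsOpen ((Set.univ : Set F) ×ˢ O) := isOpen_univ.prod hO
  have hsm : ContMDiff (𝓘(ℝ, V).prod 𝓘(ℝ, E)) 𝓘(ℝ, E) ∞ (fun z : F × M => z.1 • z.2) :=
    ContMDiffSMul.contMDiff_smul
  have hf : ContMDiffOn (𝓘(ℝ, V).prod 𝓘(ℝ, EuclideanSpace ℝ (Fin d))) 𝓘(ℝ, E) ∞ f
      ((Set.univ : Set F) ×ˢ O) :=
    hsm.comp_contMDiffOn (contMDiffOn_fst.prodMk (hσ.comp contMDiffOn_snd fun z hz => hz.2))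
  have h10 : ((1, 0) : F × EuclideanSpace ℝ (Fin d)) ∈ (Set.univ : Set F) ×ˢ O :=
    ⟨Set.mem_univ _, h0O⟩
  have hmf : MDifferentiableAt (𝓘(ℝ, V).prod 𝓘(ℝ, EuclideanSpace ℝ (Fin d))) 𝓘(ℝ, E) f (1, 0) :=
    (hf.contMDiffAt (hU.mem_nhds h10)).mdifferentiableAt (by simp)
  have hdσ : HasMFDerivAt 𝓘(ℝ, EuclideanSpace ℝ (Fin d)) 𝓘(ℝ, E) σ 0 ι := by
    have e0 : φ p + ι 0 = φ p := by simp
    have a1 : HasMFDerivAt 𝓘(ℝ, E) 𝓘(ℝ, E) φ.symm (φ p + ι 0) (ContinuousLinearMap.id ℝ E) := by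
      rw [e0]
      have h1 : MDifferentiableAt 𝓘(ℝ, E) 𝓘(ℝ, E) φ.symm (φ p) :=
        ((contMDiffOn_extChartHomeo_symm p).contMDiffAt (φ.open_target.mem_nhds
          (φ.map_source hφp))).mdifferentiableAt (by simp)
      have h2 := h1.hasMFDerivAt
      have h3 := mfderivWithin_range_extChartAt_symm (I := 𝓘(ℝ, E)) (x := p)
      rw [ModelWithCorners.range_eq_univ, mfderivWithin_univ] at h3
      exact h3 ▸ h2
    have a2 : HasMFDerivAt 𝓘(ℝ, EuclideanSpace ℝ (Fin d)) 𝓘(ℝ, E) (fun s => φ p + ι s) 0 ι := by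
      have : HasFDerivAt (fun s => φ p + ι s) ι 0 := ι.hasFDerivAt.const_add _
      exact this.hasMFDerivAt
    exact a1.comp 0 a2
  have hbij : Function.Bijective (mfderiv (𝓘(ℝ, V).prod 𝓘(ℝ, EuclideanSpace ℝ (Fin d))) 𝓘(ℝ, E)
      f (1, 0)) := by
    have : ∀ v : V × EuclideanSpace ℝ (Fin d),
        mfderiv (𝓘(ℝ, V).prod 𝓘(ℝ, EuclideanSpace ℝ (Fin d))) 𝓘(ℝ, E) f (1, 0) v =
          D.coprod ι v := by
      intro v
      refine (mfderiv_prod_eq_add_apply hmf).trans ?_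
      have b1 : (fun z : F => f (z, 0)) = fun g => g • p := by
        funext g; simp only [f, hσ0]
      have b2 : (fun z => f (1, z)) = σ := by
        funext g; simp only [f, one_smul]
      have c1 : (mfderiv 𝓘(ℝ, V) 𝓘(ℝ, E) (fun z : F => f (z, 0)) 1 : V →L[ℝ] E) = D := by
        rw [b1]
      have c2 : (mfderiv 𝓘(ℝ, EuclideanSpace ℝ (Fin d)) 𝓘(ℝ, E) (fun z => f (1, z)) 0 :
          EuclideanSpace ℝ (Fin d) →L[ℝ] E) = ι := by
        rw [b2]; exact hdσ.mfderiv
      change (mfderiv 𝓘(ℝ, V) 𝓘(ℝ, E) (fun z : F => f (z, 0)) 1 : V →L[ℝ] E) v.1 +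
        (mfderiv 𝓘(ℝ, EuclideanSpace ℝ (Fin d)) 𝓘(ℝ, E) (fun z => f (1, z)) 0 :
          EuclideanSpace ℝ (Fin d) →L[ℝ] E) v.2 = D v.1 + ι v.2
      rw [c1, c2]
      rfl
    have h2 : ⇑(mfderiv (𝓘(ℝ, V).prod 𝓘(ℝ, EuclideanSpace ℝ (Fin d))) 𝓘(ℝ, E) f (1, 0)) =
      ⇑(D.coprod ι) := funext this
    rw [h2]
    exact hι
  obtain ⟨θ, h1, h2, h3, h4⟩ := exists_isSmoothPartial_of_mfderiv_bijective hU h10 hf hbij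
  exact ⟨σ, θ, hσ0, h1, fun z hz => h3 hz, ⟨O, hO, h0O, hσ.continuousOn⟩, h4⟩

/-- The quotient of a manifold by a free proper smooth action of a Lie group, with injective
infinitesimal generators, is a manifold. -/
theorem nonempty_quotientManifoldStructure_orbitRel [T2Space M] [SecondCountableTopology M]
    (hfree : ∀ (h : F) (x : M), h • x = x → h = 1)
    (hgen : ∀ p : M, Function.Injective (mfderiv 𝓘(ℝ, V) 𝓘(ℝ, E) (fun g : F => g • p) 1)) :
    Nonempty (QuotientManifoldStructure 𝓘(ℝ, E) (MulAction.orbitRel F M)) := by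
  have : CompleteSpace E := FiniteDimensional.complete ℝ E
  have : CompleteSpace V := FiniteDimensional.complete ℝ V
  have hsm : ContMDiff (𝓘(ℝ, V).prod 𝓘(ℝ, E)) 𝓘(ℝ, E) ∞ (fun z : F × M => z.1 • z.2) :=
    ContMDiffSMul.contMDiff_smul
  refine nonempty_quotientManifoldStructure_of_adapted (W := V)
    (d := Module.finrank ℝ E - Module.finrank ℝ V) (isOpenMap_quotient_mk'_mul (Γ := F)) ?_ ?_ ?_
  · intro p
    obtain ⟨σ, θ, hσ0, h10, hθ, ⟨O, hO, h0O, hσ⟩, hθs⟩ := exists_smul_slice p (hgen p)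
    obtain ⟨W₀, B₀, hW₀, hB₀, h1W₀, h0B₀, hWB⟩ := isOpen_prod_iff.1 θ.open_source 1 0 h10
    -- Local injectivity of θ does not prevent a distant group element from returning an orbit to
    -- the slice. Keeping the slice inside `N` confines such elements to `W₀`, where θ is injective.
    obtain ⟨N, hN, hpN, hNW⟩ := exists_nhds_smul_mem hfree p hW₀ h1W₀
    let d := Module.finrank ℝ E - Module.finrank ℝ V
    let B : Set (EuclideanSpace ℝ (Fin d)) := B₀ ∩ (O ∩ σ ⁻¹' N)
    have hB : IsOpen B := hB₀.inter (hσ.isOpen_inter_preimage hO hN)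
    have h0B : (0 : EuclideanSpace ℝ (Fin d)) ∈ B := ⟨h0B₀, h0O, by rwa [Set.mem_preimage, hσ0]⟩
    let κ := chartAt V (1 : F)
    have hsub : W₀ ×ˢ B ⊆ θ.source := fun z hz => hWB ⟨hz.1, hz.2.1⟩
    let θ' := θ.restrOpen (W₀ ×ˢ B) (hW₀.prod hB)
    let ψ : OpenPartialHomeomorph M (EuclideanSpace ℝ (Fin d) × V) :=
      (θ'.symm ≫ₕ (κ.prod (OpenPartialHomeomorph.refl _))).transHomeomorph
        (Homeomorph.prodComm V (EuclideanSpace ℝ (Fin d)))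
    have hsrc' : ∀ x, x ∈ ψ.source ↔
        (x ∈ θ.target ∧ θ.symm x ∈ W₀ ×ˢ B) ∧ (θ.symm x).1 ∈ κ.source := by
      intro x
      simp only [ψ, θ', mfld_simps, OpenPartialHomeomorph.transHomeomorph_source]
    have hsrc : ∀ x ∈ ψ.source, x ∈ θ.target ∧ (θ.symm x).1 ∈ W₀ ∧ (θ.symm x).2 ∈ B ∧
        (θ.symm x).1 ∈ κ.source ∧ (θ.symm x).1 • σ (θ.symm x).2 = x := by
      intro x hx
      rw [hsrc'] at hx
      have := hθ _ (θ.map_target hx.1.1)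
      rw [θ.right_inv hx.1.1] at this
      exact ⟨hx.1.1, hx.1.2.1, hx.1.2.2, hx.2, this.symm⟩
    have hψ : ∀ x, ψ x = ((θ.symm x).2, κ (θ.symm x).1) := fun x => rfl
    have hψs : ∀ z, ψ.symm z = θ (κ.symm z.2, z.1) := fun z => rfl
    have hθ10 : θ (1, 0) = p := by rw [hθ _ h10, one_smul, hσ0]
    have hθp : θ.symm p = (1, 0) := by rw [← hθ10, θ.left_inv h10]
    have htgt : ∀ z : EuclideanSpace ℝ (Fin d) × V, z ∈ ψ.target ↔
        (z.2 ∈ κ.target ∧ κ.symm z.2 ∈ W₀ ∧ z.1 ∈ B) := by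
      intro z
      simp only [ψ, θ', mfld_simps, OpenPartialHomeomorph.transHomeomorph_target]
      constructor
      · rintro ⟨h1, h2, h3⟩
        exact ⟨h1, h3⟩
      · rintro ⟨h1, h3⟩
        exact ⟨h1, hsub h3, h3⟩
    refine ⟨ψ, ?_, ⟨?_, ?_⟩, ⟨?_, ?_⟩⟩
    · rw [hsrc']
      refine ⟨⟨hθ10 ▸ θ.map_source h10, ?_, ?_⟩, ?_⟩
      · rw [hθp]; exact h1W₀
      · rw [hθp]; exact h0B
      · rw [hθp]; exact mem_chart_source V (1 : F)
    · have a1 := hθs.invFun.mono (t := ψ.source) fun x hx => (hsrc x hx).1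
      have a2 : ContMDiffOn 𝓘(ℝ, E) 𝓘(ℝ, V) ∞ (fun x => κ (θ.symm x).1) ψ.source :=
        (contMDiffOn_chart (I := 𝓘(ℝ, V)) (n := ∞) (x := (1 : F))).comp
          (contMDiff_fst.comp_contMDiffOn a1)
          fun x hx => (hsrc x hx).2.2.2.1
      exact (contMDiff_snd.comp_contMDiffOn a1).prodMk_space a2
    · have a1 : ContMDiffOn 𝓘(ℝ, EuclideanSpace ℝ (Fin d) × V) 𝓘(ℝ, V) ∞
          (fun z : EuclideanSpace ℝ (Fin d) × V => κ.symm z.2) ψ.target :=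
        (contMDiffOn_chart_symm (I := 𝓘(ℝ, V)) (n := ∞) (x := (1 : F))).comp
          (contDiff_snd.contMDiff.contMDiffOn) fun z hz => ((htgt z).1 hz).1
      have a2 : ContMDiffOn 𝓘(ℝ, EuclideanSpace ℝ (Fin d) × V) 𝓘(ℝ, EuclideanSpace ℝ (Fin d)) ∞
          (fun z : EuclideanSpace ℝ (Fin d) × V => z.1) ψ.target :=
        contDiff_fst.contMDiff.contMDiffOn
      exact hθs.toFun.comp (a1.prodMk a2) fun z hz => hsub ((htgt z).1 hz).2
    · intro x hx y hy
      obtain ⟨hx1, hx2, hx3, hx4, hx5⟩ := hsrc x hx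
      obtain ⟨hy1, hy2, hy3, hy4, hy5⟩ := hsrc y hy
      rw [hψ, hψ]
      change x ∈ MulAction.orbit F y ↔ (θ.symm x).2 = (θ.symm y).2
      constructor
      · rintro ⟨h, hh⟩
        change h • y = x at hh
        -- With x = g_x • σ(s_x) and y = g_y • σ(s_y), the element g_x⁻¹ h g_y carries σ(s_y) to
        -- σ(s_x). It lies in `W₀`, so injectivity of θ forces s_x = s_y.
        have e1 : ((θ.symm x).1⁻¹ * h * (θ.symm y).1) • σ (θ.symm y).2 = σ (θ.symm x).2 := by
          rw [mul_smul, mul_smul, hy5, hh, inv_smul_eq_iff, hx5]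
        have e2 : (θ.symm x).1⁻¹ * h * (θ.symm y).1 ∈ W₀ :=
          hNW _ _ hy3.2.2 (by rw [e1]; exact hx3.2.2)
        have m1 : ((θ.symm x).1⁻¹ * h * (θ.symm y).1, (θ.symm y).2) ∈ θ.source :=
          hWB ⟨e2, hy3.1⟩
        have m2 : ((1 : F), (θ.symm x).2) ∈ θ.source := hWB ⟨h1W₀, hx3.1⟩
        have e3 := θ.injOn m1 m2 (by rw [hθ _ m1, hθ _ m2, e1, one_smul])
        exact (congrArg Prod.snd e3).symm
      · intro he
        refine ⟨(θ.symm x).1 * (θ.symm y).1⁻¹, ?_⟩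
        change ((θ.symm x).1 * (θ.symm y).1⁻¹) • y = x
        rw [mul_smul, inv_smul_eq_iff.2 hy5.symm, ← he, hx5]
    · intro z hz
      have hκ : (1 : F) ∈ κ.source := mem_chart_source V (1 : F)
      rw [htgt] at hz ⊢
      simp only [hψ, hθp]
      exact ⟨κ.map_source hκ, by rw [κ.left_inv hκ]; exact h1W₀, hz.2.2⟩
  · rintro x y ⟨h, hh⟩
    refine ⟨fun z => h⁻¹ • z, hsm.comp (contMDiff_const.prodMk contMDiff_id), ?_, fun z => ?_⟩
    · rw [inv_smul_eq_iff]; exact hh.symm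
    · exact ⟨h, smul_inv_smul h z⟩
  · intro p
    let D : V →L[ℝ] E := mfderiv 𝓘(ℝ, V) 𝓘(ℝ, E) (fun g : F => g • p) 1
    have h := exists_bijective_coprod_of_injective D (hgen p)
    let e := ContinuousLinearEquiv.ofBijective (D.coprod h.choose)
      (LinearMap.ker_eq_bot.2 h.choose_spec.1) (LinearMap.range_eq_top.2 h.choose_spec.2)
    exact (ContinuousLinearEquiv.prodComm ℝ _ _).trans e

end Actions

/-! ### Local sections of submersions -/

section Submersions

variable {E : Type*} [NormedAddCommGroup E] [NormedSpace ℝ E]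
  {H : Type*} [TopologicalSpace H] {I : ModelWithCorners ℝ E H} [I.Boundaryless]
  {M : Type*} [TopologicalSpace M] [ChartedSpace H M] [IsManifold I ∞ M]
  {E' : Type*} [NormedAddCommGroup E'] [NormedSpace ℝ E']
  {H' : Type*} [TopologicalSpace H'] {J : ModelWithCorners ℝ E' H'} [J.Boundaryless]
  {N : Type*} [TopologicalSpace N] [ChartedSpace H' N] [IsManifold J ∞ N]
  {E'' : Type*} [NormedAddCommGroup E''] [NormedSpace ℝ E'']
  {H'' : Type*} [TopologicalSpace H''] {K : ModelWithCorners ℝ E'' H''}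
  {P : Type*} [TopologicalSpace P] [ChartedSpace H'' P]

/-- A submersion has smooth local sections. -/
theorem exists_contMDiffAt_section {f : M → N} (hf : Manifold.IsSubmersion I J ∞ f) (x : M) :
    ∃ s : N → M, ContMDiffAt J I ∞ s (f x) ∧ s (f x) = x ∧ ∀ᶠ z in 𝓝 (f x), f (s z) = z := by
  have h := (hf.isSubmersionAt x).isSubmersionAtOfComplement_complement
  let φ := h.domChart
  let χ := h.codChart
  let e := h.equiv
  have hxφ : x ∈ φ.source := h.mem_domChart_source
  have hxχ : f x ∈ χ.source := h.mem_codChart_source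
  have hw := h.writtenInCharts
  have hxt : φ.extend I x ∈ (φ.extend I).target :=
    (φ.extend I).map_source (by rwa [φ.extend_source])
  have hopen : IsOpen (φ.extend I).target := φ.isOpen_extend_target
  -- In normal-form charts `f` is a first projection. The section freezes the second component at
  -- its value at `x`.
  let s : N → M := fun z => (φ.extend I).symm (e.symm (χ.extend J z, (e (φ.extend I x)).2))
  have h1 : (χ.extend J (f x), (e (φ.extend I x)).2) = e (φ.extend I x) := by
    have := hw hxt
    simp only [Function.comp_apply] at this
    rw [show h.domChart = φ from rfl, φ.extend_left_inv hxφ] at this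
    exact Prod.ext this rfl
  have hsx : s (f x) = x := by
    simp only [s, h1, e.symm_apply_apply]
    exact φ.extend_left_inv hxφ
  have hsm1 : ContMDiffAt J 𝓘(ℝ, E) ∞
      (fun z => e.symm (χ.extend J z, (e (φ.extend I x)).2)) (f x) := by
    refine e.symm.contDiff.contMDiff.contMDiffAt.comp (f x) ?_
    exact (χ.contMDiffAt_extend h.codChart_mem_maximalAtlas hxχ).prodMk_space contMDiffAt_const
  have hval : e.symm (χ.extend J (f x), (e (φ.extend I x)).2) = φ.extend I x := by
    rw [h1, e.symm_apply_apply]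
  have hsm : ContMDiffAt J I ∞ s (f x) := by
    refine ContMDiffAt.comp (f x) (I' := 𝓘(ℝ, E)) (g := (φ.extend I).symm) ?_ hsm1
    rw [hval]
    refine (contMDiffOn_extend_symm h.domChart_mem_maximalAtlas).contMDiffAt ?_
    have : I '' φ.target = (φ.extend I).target := by
      rw [φ.extend_target, I.image_eq]
    exact this ▸ hopen.mem_nhds hxt
  refine ⟨s, hsm, hsx, ?_⟩
  have hn1 : ∀ᶠ z in 𝓝 (f x), e.symm (χ.extend J z, (e (φ.extend I x)).2) ∈ (φ.extend I).target :=
    hsm1.continuousAt.preimage_mem_nhds (by rw [hval]; exact hopen.mem_nhds hxt)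
  filter_upwards [hn1, χ.open_source.mem_nhds hxχ] with z hz1 hz2
  have h2 := hw hz1
  simp only [Function.comp_apply] at h2
  rw [show h.equiv = e from rfl, e.apply_symm_apply] at h2
  have h3 : s z ∈ φ.source := by
    have := (φ.extend I).map_target hz1
    rwa [φ.extend_source] at this
  have h4 : f (s z) ∈ χ.source := h.source_subset_preimage_source h3
  exact (χ.extend J).injOn (by rwa [χ.extend_source]) (by rwa [χ.extend_source]) h2

/-- Smoothness descends along surjective submersions. -/
theorem contMDiff_of_comp_isSubmersion {f : M → N} (hf : Manifold.IsSubmersion I J ∞ f)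
    (hsurj : Function.Surjective f) {g : N → P} (hg : ContMDiff I K ∞ (g ∘ f)) :
    ContMDiff J K ∞ g := by
  intro y
  obtain ⟨x, rfl⟩ := hsurj y
  obtain ⟨s, hs, hsx, hfs⟩ := exists_contMDiffAt_section hf x
  refine ((hg (s (f x))).comp (f x) hs).congr_of_eventuallyEq ?_
  filter_upwards [hfs] with z hz
  simp only [Function.comp_apply, hz]

end Submersions

/-! ### Exterior derivative and pull-back -/

section Forms

variable {E : Type*} [NormedAddCommGroup E] [NormedSpace ℝ E]
  {H : Type*} [TopologicalSpace H] {I : ModelWithCorners ℝ E H} [I.Boundaryless]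
  {M : Type*} [TopologicalSpace M] [ChartedSpace H M] [IsManifold I ∞ M]
  {E' : Type*} [NormedAddCommGroup E'] [NormedSpace ℝ E']
  {H' : Type*} [TopologicalSpace H'] {I' : ModelWithCorners ℝ E' H'} [I'.Boundaryless]
  {M' : Type*} [TopologicalSpace M'] [ChartedSpace H' M'] [IsManifold I' ∞ M']
  {n : ℕ}

/-- The expression of a form in the chart at `x`. -/
def localForm (θ : DForm I M n) (x : M) : E → E [⋀^Fin n]→L[ℝ] ℝ := fun y =>
  (θ ((extChartAt I x).symm y)).compContinuousLinearMap
    (mfderiv 𝓘(ℝ, E) I (extChartAt I x).symm y)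

theorem dForm_apply (θ : DForm I M n) (x : M) : dForm θ x =
    (extDeriv (localForm θ x) (extChartAt I x x)).compContinuousLinearMap
      (mfderiv I 𝓘(ℝ, E) (extChartAt I x) x) := rfl

theorem dform_comp_congr {X : Type*} [NormedAddCommGroup X] [NormedSpace ℝ X]
    (θ : DForm I M n) {a b : M} (hab : a = b) {A B : X →L[ℝ] E} (hAB : A = B) :
    ((θ a : E [⋀^Fin n]→L[ℝ] ℝ).compContinuousLinearMap A : X [⋀^Fin n]→L[ℝ] ℝ) =
      (θ b : E [⋀^Fin n]→L[ℝ] ℝ).compContinuousLinearMap B := by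
  subst hab hAB
  rfl

variable (I I') in
/-- The expression of a map in the charts at `x` and `f x`. -/
def localMap (f : M → M') (x : M) : E → E' := extChartAt I' (f x) ∘ f ∘ (extChartAt I x).symm

theorem mdifferentiableAt_extChartAt_symm {x : M} {y : E} (hy : y ∈ (extChartAt I x).target) :
    MDifferentiableAt 𝓘(ℝ, E) I (extChartAt I x).symm y :=
  ((contMDiffOn_extChartAt_symm (n := ∞) x).contMDiffAt
    ((isOpen_extChartAt_target x).mem_nhds hy)).mdifferentiableAt (by simp)

theorem eventually_localMap {f : M → M'} (hf : ContMDiff I I' ∞ f) (x : M) :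
    ∀ᶠ y in 𝓝 (extChartAt I x x), y ∈ (extChartAt I x).target ∧
      f ((extChartAt I x).symm y) ∈ (extChartAt I' (f x)).source := by
  have h0 : (extChartAt I x).symm (extChartAt I x x) = x := extChartAt_to_inv x
  have h1 : ContinuousAt (fun y => f ((extChartAt I x).symm y)) (extChartAt I x x) :=
    hf.continuous.continuousAt.comp (continuousAt_extChartAt_symm x)
  filter_upwards [extChartAt_target_mem_nhds (I := I) x, h1.preimage_mem_nhds
    (by rw [h0]; exact extChartAt_source_mem_nhds (I := I') (f x))] with y a b using ⟨a, b⟩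

theorem contDiffAt_localMap {f : M → M'} (hf : ContMDiff I I' ∞ f) (x : M) {y : E}
    (hy : y ∈ (extChartAt I x).target)
    (hfy : f ((extChartAt I x).symm y) ∈ (extChartAt I' (f x)).source) :
    ContDiffAt ℝ ∞ (localMap I I' f x) y := by
  have h1 : ContMDiffAt 𝓘(ℝ, E) I ∞ (extChartAt I x).symm y :=
    (contMDiffOn_extChartAt_symm x).contMDiffAt ((isOpen_extChartAt_target x).mem_nhds hy)
  have h2 : ContMDiffAt I' 𝓘(ℝ, E') ∞ (extChartAt I' (f x)) (f ((extChartAt I x).symm y)) :=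
    contMDiffAt_extChartAt' (by rwa [extChartAt_source] at hfy)
  exact contMDiffAt_iff_contDiffAt.1 (h2.comp y ((hf _).comp y h1))

/-- Near the base point f ∘ φ⁻¹ = χ⁻¹ ∘ `localMap`, with φ and χ the charts at x and f(x); the chain
rule then equates the two expressions. -/
theorem localForm_pullbackForm {f : M → M'} (hf : ContMDiff I I' ∞ f) (θ : DForm I' M' n) (x : M) :
    localForm (pullbackForm (I := I) f θ) x =ᶠ[𝓝 (extChartAt I x x)] fun y =>
      (localForm θ (f x) (localMap I I' f x y)).compContinuousLinearMap
        (fderiv ℝ (localMap I I' f x) y) := by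
  filter_upwards [(eventually_localMap hf x).eventually_nhds] with y hy
  obtain ⟨hy1, hy2⟩ := hy.self_of_nhds
  have hval : ∀ z, f ((extChartAt I x).symm z) ∈ (extChartAt I' (f x)).source →
      (extChartAt I' (f x)).symm (localMap I I' f x z) = f ((extChartAt I x).symm z) :=
    fun z hz => (extChartAt I' (f x)).left_inv hz
  have hd1 := (mdifferentiableAt_extChartAt_symm (I := I) hy1).hasMFDerivAt
  have hd2 : HasMFDerivAt I I' f ((extChartAt I x).symm y)
      (mfderiv I I' f ((extChartAt I x).symm y)) :=
    ((hf _).mdifferentiableAt (by simp)).hasMFDerivAt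
  have hd3 : HasMFDerivAt 𝓘(ℝ, E) 𝓘(ℝ, E') (localMap I I' f x) y
      (fderiv ℝ (localMap I I' f x) y : E →L[ℝ] E') :=
    ((contDiffAt_localMap hf x hy1 hy2).differentiableAt (by simp)).hasFDerivAt.hasMFDerivAt
  have hd4 := (mdifferentiableAt_extChartAt_symm (I := I') (x := f x)
    (y := localMap I I' f x y) ((extChartAt I' (f x)).map_source hy2)).hasMFDerivAt
  have hlin := hasMFDerivAt_unique (hd2.comp y hd1) ((hd4.comp y hd3).congr_of_eventuallyEq (by
    filter_upwards [hy] with z hz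
    exact (hval z hz.2).symm))
  exact dform_comp_congr (X := E) θ (hval y hy2).symm hlin

/-- The exterior derivative commutes with pull-backs. -/
theorem dForm_pullbackForm {f : M → M'} (hf : ContMDiff I I' ∞ f) (θ : DForm I' M' n) (x : M)
    (hθ : DifferentiableAt ℝ (localForm θ (f x)) (extChartAt I' (f x) (f x))) :
    dForm (pullbackForm (I := I) f θ) x = pullbackForm f (dForm θ) x := by
  have hself := (eventually_localMap hf x).self_of_nhds
  have h0 : localMap I I' f x (extChartAt I x x) = extChartAt I' (f x) (f x) := by
    simp only [localMap, Function.comp_apply, extChartAt_to_inv]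
  have hF := contDiffAt_localMap hf x hself.1 hself.2
  -- Both exterior derivatives are taken in the charts at x and at f(x), so naturality in vector
  -- spaces suffices and independence of the chart is not needed.
  rw [dForm_apply, (localForm_pullbackForm hf θ x).extDeriv_eq,
    extDeriv_pullback (r := ∞) (by rwa [h0]) hF
      (by rw [minSmoothness_of_isRCLikeNormedField]; exact ENat.LEInfty.out), h0]
  have hd1 : HasMFDerivAt I 𝓘(ℝ, E) (extChartAt I x) x (mfderiv I 𝓘(ℝ, E) (extChartAt I x) x) :=
    (mdifferentiableAt_extChartAt (mem_chart_source H x)).hasMFDerivAt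
  have hd2 : HasMFDerivAt 𝓘(ℝ, E) 𝓘(ℝ, E') (localMap I I' f x) (extChartAt I x x)
      (fderiv ℝ (localMap I I' f x) (extChartAt I x x) : E →L[ℝ] E') :=
    (hF.differentiableAt (by simp)).hasFDerivAt.hasMFDerivAt
  have hd3 : HasMFDerivAt I I' f x (mfderiv I I' f x) :=
    ((hf _).mdifferentiableAt (by simp)).hasMFDerivAt
  have hd4 : HasMFDerivAt I' 𝓘(ℝ, E') (extChartAt I' (f x)) (f x)
      (mfderiv I' 𝓘(ℝ, E') (extChartAt I' (f x)) (f x)) :=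
    (mdifferentiableAt_extChartAt (mem_chart_source H' (f x))).hasMFDerivAt
  have hlin := hasMFDerivAt_unique (hd2.comp x hd1) ((hd4.comp x hd3).congr_of_eventuallyEq (by
    filter_upwards [extChartAt_source_mem_nhds (I := I) x] with z hz
    simp only [localMap, Function.comp_apply, (extChartAt I x).left_inv hz]))
  ext v
  exact congrArg (extDeriv (localForm θ (f x)) (extChartAt I' (f x) (f x)))
    (funext fun i => DFunLike.congr_fun hlin (v i))

theorem localForm_add (θ θ' : DForm I M n) (x : M) :
    localForm (θ + θ') x = localForm θ x + localForm θ' x := rfl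

theorem localForm_smul (c : ℝ) (θ : DForm I M n) (x : M) :
    localForm (c • θ) x = c • localForm θ x := rfl

theorem dForm_add {θ θ' : DForm I M n} {x : M}
    (h : DifferentiableAt ℝ (localForm θ x) (extChartAt I x x))
    (h' : DifferentiableAt ℝ (localForm θ' x) (extChartAt I x x)) :
    dForm (θ + θ') x = dForm θ x + dForm θ' x := by
  rw [dForm_apply, localForm_add, extDeriv_add h h']
  rfl

theorem dForm_smul (c : ℝ) (θ : DForm I M n) (x : M) :
    dForm (c • θ) x = c • dForm θ x := by
  rw [dForm_apply, localForm_smul, extDeriv_smul]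
  rfl

/-- Additivity of `dForm` requires differentiable summands, so differentiability of the partial sums
is carried through the induction. -/
theorem differentiableAt_localForm_sum {ι : Type*} (t : Finset ι) {θ : ι → DForm I M n} {x : M}
    (h : ∀ i ∈ t, DifferentiableAt ℝ (localForm (θ i) x) (extChartAt I x x)) :
    DifferentiableAt ℝ (localForm (∑ i ∈ t, θ i) x) (extChartAt I x x) ∧
      dForm (∑ i ∈ t, θ i) x = ∑ i ∈ t, dForm (θ i) x := by
  classical
  induction t using Finset.induction_on with
  | empty =>
    have h0 : localForm (0 : DForm I M n) x = fun _ => 0 := rfl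
    refine ⟨by simp [h0], ?_⟩
    have := dForm_smul 0 (0 : DForm I M n) x
    simp only [zero_smul, Finset.sum_empty] at this ⊢
    exact this
  | insert i t hi ih =>
    have h1 := ih fun j hj => h j (Finset.mem_insert_of_mem hj)
    have h2 := h i (Finset.mem_insert_self i t)
    rw [Finset.sum_insert hi, Finset.sum_insert hi]
    exact ⟨by rw [localForm_add]; exact h2.add h1.1, by rw [dForm_add h2 h1.1, h1.2]⟩

/-- The derivative of `f` is a factor of the local expression, so its differentiability rests on `f`
being twice differentiable. -/
theorem differentiableAt_localForm_pullbackForm {f : M → M'} (hf : ContMDiff I I' ∞ f)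
    (θ : DForm I' M' n) (x : M)
    (hθ : DifferentiableAt ℝ (localForm θ (f x)) (extChartAt I' (f x) (f x))) :
    DifferentiableAt ℝ (localForm (pullbackForm (I := I) f θ) x) (extChartAt I x x) := by
  have hself := (eventually_localMap hf x).self_of_nhds
  have h0 : localMap I I' f x (extChartAt I x x) = extChartAt I' (f x) (f x) := by
    simp only [localMap, Function.comp_apply, extChartAt_to_inv]
  have hF := contDiffAt_localMap hf x hself.1 hself.2
  refine DifferentiableAt.congr_of_eventuallyEq ?_ (localForm_pullbackForm hf θ x)
  have h1 : DifferentiableAt ℝ (fun y => localForm θ (f x) (localMap I I' f x y))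
      (extChartAt I x x) := DifferentiableAt.comp (g := localForm θ (f x)) (extChartAt I x x) (by rwa [h0])
        (hF.differentiableAt (by simp))
  have h2 : DifferentiableAt ℝ (fderiv ℝ (localMap I I' f x)) (extChartAt I x x) :=
    (hF.fderiv_right (m := 1)
      (by rw [one_add_one_eq_two]; exact ENat.LEInfty.out)).differentiableAt one_ne_zero
  exact h1.continuousAlternatingMapCompContinuousLinearMap h2

end Forms

/-! ### Topology of total spaces of bundles -/

section TotalSpaces

variable {B : Type*} [TopologicalSpace B] {F : Type*} [TopologicalSpace F]
  {E : B → Type*} [TopologicalSpace (TotalSpace F E)] [∀ b, TopologicalSpace (E b)]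
  [FiberBundle F E]

/-- Points over distinct base points are separated in the base, points of one fibre inside a
trivialization. -/
theorem FiberBundle.t2Space_totalSpace [T2Space B] [T2Space F] : T2Space (TotalSpace F E) := by
  refine ⟨fun x y hxy => ?_⟩
  have hπ : Continuous (TotalSpace.proj : TotalSpace F E → B) := FiberBundle.continuous_proj F E
  by_cases hb : x.proj = y.proj
  · let e := trivializationAt F E x.proj
    have hx : x ∈ e.source := FiberBundle.mem_trivializationAt_proj_source
    have hy : y ∈ e.source := by
      rw [e.mem_source, ← hb]
      exact FiberBundle.mem_baseSet_trivializationAt' x.proj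
    have hne : e x ≠ e y := fun h => hxy (e.injOn hx hy h)
    obtain ⟨u, v, hu, hv, hxu, hyv, huv⟩ := t2_separation hne
    refine ⟨e.source ∩ e ⁻¹' u, e.source ∩ e ⁻¹' v,
      e.continuousOn.isOpen_inter_preimage e.open_source hu,
      e.continuousOn.isOpen_inter_preimage e.open_source hv, ⟨hx, hxu⟩, ⟨hy, hyv⟩, ?_⟩
    exact (huv.preimage e).mono Set.inter_subset_right Set.inter_subset_right
  · obtain ⟨u, v, hu, hv, hxu, hyv, huv⟩ := t2_separation hb
    exact ⟨_, _, hu.preimage hπ, hv.preimage hπ, hxu, hyv, huv.preimage _⟩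

/-- By second countability of the base, countably many trivializations cover; each of their sources
is homeomorphic to an open part of B × F. -/
theorem FiberBundle.secondCountableTopology_totalSpace [SecondCountableTopology B]
    [SecondCountableTopology F] : SecondCountableTopology (TotalSpace F E) := by
  obtain ⟨s, hs, hsU⟩ := TopologicalSpace.countable_cover_nhds
    (f := fun b : B => (trivializationAt F E b).baseSet) fun b =>
      (trivializationAt F E b).open_baseSet.mem_nhds (FiberBundle.mem_baseSet_trivializationAt' b)
  have : Countable s := hs.to_subtype
  have hsc : ∀ b : s, SecondCountableTopology (trivializationAt F E (b : B)).source := fun b =>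
    (trivializationAt F E (b : B)).toOpenPartialHomeomorph.secondCountableTopology_source
  refine TopologicalSpace.secondCountableTopology_of_countable_cover
    (U := fun b : s => (trivializationAt F E (b : B)).source)
    (fun b => (trivializationAt F E (b : B)).open_source) ?_
  refine Set.eq_univ_of_forall fun x => ?_
  have : x.proj ∈ ⋃ b ∈ s, (trivializationAt F E b).baseSet := hsU ▸ Set.mem_univ _
  simp only [Set.mem_iUnion] at this
  obtain ⟨b, hb, hx⟩ := this
  exact Set.mem_iUnion.2 ⟨⟨b, hb⟩, (Trivialization.mem_source _).2 hx⟩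

end TotalSpaces

/-! ### Smooth maps into the cotangent bundle -/

section CotangentBundle

variable {E : Type*} [NormedAddCommGroup E] [NormedSpace ℝ E] [FiniteDimensional ℝ E]
  {Q : Type*} [TopologicalSpace Q] [ChartedSpace E Q] [IsManifold 𝓘(ℝ, E) ∞ Q]
  {EN : Type*} [NormedAddCommGroup EN] [NormedSpace ℝ EN]
  {HN : Type*} [TopologicalSpace HN] {J : ModelWithCorners ℝ EN HN}
  {N : Type*} [TopologicalSpace N] [ChartedSpace HN N]
  {W : Type*} [NormedAddCommGroup W] [NormedSpace ℝ W]

/-- The bundle of `W`-valued covectors. -/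
abbrev HomTangent (E : Type*) [NormedAddCommGroup E] [NormedSpace ℝ E]
    (Q : Type*) [TopologicalSpace Q] [ChartedSpace E Q] [IsManifold 𝓘(ℝ, E) ∞ Q]
    (W : Type*) [NormedAddCommGroup W] [NormedSpace ℝ W] : Type _ :=
  TotalSpace (E →L[ℝ] W) (fun x : Q => TangentSpace 𝓘(ℝ, E) x →L[ℝ] Bundle.Trivial Q W x)

/-- The inverse of the trivialization at `x` of the tangent bundle, on the fibre over `y`. -/
def tangentFrame (x y : Q) : E →L[ℝ] E :=
  (trivializationAt E (TangentSpace 𝓘(ℝ, E)) x).symmL ℝ y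

/-- The target bundle is trivial, so the fibre coordinate of a covector is just its composite with a
local frame of the tangent bundle. -/
theorem contMDiffAt_homTangent {f : N → HomTangent E Q W} {p : N} :
    ContMDiffAt J (𝓘(ℝ, E).prod 𝓘(ℝ, E →L[ℝ] W)) ∞ f p ↔
      ContMDiffAt J 𝓘(ℝ, E) ∞ (fun z => (f z).1) p ∧
      ContMDiffAt J 𝓘(ℝ, E →L[ℝ] W) ∞ (fun z =>
        (show E →L[ℝ] W from (f z).2).comp (tangentFrame (f p).1 (f z).1)) p := by
  rw [contMDiffAt_hom_bundle]
  refine and_congr_right fun _ => ?_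
  have : (fun z => ContinuousLinearMap.inCoordinates E (TangentSpace 𝓘(ℝ, E)) W
      (Bundle.Trivial Q W) (f p).1 (f z).1 (f p).1 (f z).1 (f z).2) = fun z =>
      (show E →L[ℝ] W from (f z).2).comp (tangentFrame (f p).1 (f z).1) := by
    funext z
    ext v
    simp [ContinuousLinearMap.inCoordinates, tangentFrame]
    rfl
  rw [this]

end CotangentBundle

section DualBasis

variable {EN : Type*} [NormedAddCommGroup EN] [NormedSpace ℝ EN]
  {HN : Type*} [TopologicalSpace HN] {J : ModelWithCorners ℝ EN HN}
  {N : Type*} [TopologicalSpace N] [ChartedSpace HN N]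
  {V : Type*} [NormedAddCommGroup V] [NormedSpace ℝ V]

/-- The dual of a smooth frame is smooth. -/
theorem contMDiff_dualBasis {k : ℕ} {η : Fin k → N → V} (hη : ∀ i, ContMDiff J 𝓘(ℝ, V) ∞ (η i))
    (hspan : ∀ x, Submodule.span ℝ (Set.range fun i => η i x) = ⊤)
    {μ : Fin k → N → V →L[ℝ] ℝ} (hμ : ∀ i j x, μ i x (η j x) = if i = j then 1 else 0)
    (i : Fin k) : ContMDiff J 𝓘(ℝ, V →L[ℝ] ℝ) ∞ (μ i) := by
  let B : N → (Fin k → ℝ) →L[ℝ] V := fun x =>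
    ∑ i, (ContinuousLinearMap.proj (R := ℝ) (φ := fun _ : Fin k => ℝ) i).smulRight (η i x)
  let C : N → V →L[ℝ] (Fin k → ℝ) := fun x => ContinuousLinearMap.pi fun i => μ i x
  have hB : ∀ x a, B x a = ∑ i, a i • η i x := fun x a => by
    simp [B]
  have hCη : ∀ x j, C x (η j x) = Pi.single j 1 := fun x j => by
    ext l
    simp [C, hμ, Pi.single_apply]
  have hBη : ∀ x j, B x (Pi.single j 1) = η j x := fun x j => by
    rw [hB]
    simp [Pi.single_apply]
  have hCB : ∀ x, Function.LeftInverse (C x) (B x) := fun x a => by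
    rw [hB, map_sum]
    simp only [map_smul, hCη]
    ext l
    simp [Pi.single_apply]
  have hBC : ∀ x, Function.RightInverse (C x) (B x) := fun x v => by
    have hv : v ∈ Submodule.span ℝ (Set.range fun i => η i x) := hspan x ▸ Submodule.mem_top
    induction hv using Submodule.span_induction with
    | mem v hv =>
      obtain ⟨j, rfl⟩ := hv
      simp only [hCη, hBη]
    | zero => simp
    | add v w _ _ hv hw => rw [map_add, map_add, hv, hw]
    | smul a v _ hv => rw [map_smul, map_smul, hv]
  let e : N → (Fin k → ℝ) ≃L[ℝ] V := fun x =>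
    ContinuousLinearEquiv.equivOfInverse (B x) (C x) (hCB x) (hBC x)
  have hBs : ContMDiff J 𝓘(ℝ, (Fin k → ℝ) →L[ℝ] V) ∞ B := by
    refine ContMDiff.sum fun i _ => ?_
    exact ((ContinuousLinearMap.smulRightL ℝ (Fin k → ℝ) V
      (ContinuousLinearMap.proj i)).contDiff.contMDiff).comp (hη i)
  have hCs : ContMDiff J 𝓘(ℝ, V →L[ℝ] (Fin k → ℝ)) ∞ C := by
    -- The dual frame is the inverse of the frame, and inversion of continuous linear maps is smooth
    -- at invertible ones.
    have hCinv : C = fun x => ContinuousLinearMap.inverse (B x) := by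
      funext x
      exact (ContinuousLinearMap.inverse_equiv (e x)).symm
    rw [hCinv]
    intro x
    have h1 : ContDiffAt ℝ ∞ (ContinuousLinearMap.inverse : ((Fin k → ℝ) →L[ℝ] V) → _) (B x) :=
      contDiffAt_map_inverse (e x)
    exact h1.contMDiffAt.comp x (hBs x)
  exact ((ContinuousLinearMap.compL ℝ V (Fin k → ℝ) ℝ
    (ContinuousLinearMap.proj i)).contDiff.contMDiff).comp hCs

end DualBasis

section CotangentMaps

variable {E : Type*} [NormedAddCommGroup E] [NormedSpace ℝ E] [FiniteDimensional ℝ E]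
  {Q : Type*} [TopologicalSpace Q] [ChartedSpace E Q] [IsManifold 𝓘(ℝ, E) ∞ Q]
  {EN : Type*} [NormedAddCommGroup EN] [NormedSpace ℝ EN]
  {HN : Type*} [TopologicalSpace HN] {J : ModelWithCorners ℝ EN HN}
  {N : Type*} [TopologicalSpace N] [ChartedSpace HN N]
  {W : Type*} [NormedAddCommGroup W] [NormedSpace ℝ W]

/-- The trivialization at `x` of the tangent bundle, on the fibre over `y`. -/
def tangentCoframe (x y : Q) : E →L[ℝ] E :=
  (trivializationAt E (TangentSpace 𝓘(ℝ, E)) x).continuousLinearMapAt ℝ y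

theorem tangentFrame_tangentCoframe {x y : Q}
    (hy : y ∈ (trivializationAt E (TangentSpace 𝓘(ℝ, E)) x).baseSet) (v : E) :
    tangentFrame x y (tangentCoframe x y v) = v :=
  (trivializationAt E (TangentSpace 𝓘(ℝ, E)) x).symmL_continuousLinearMapAt hy v

/-- A field of `W`-valued covectors, as a section of the bundle. -/
def covectorSection (β : Q → E →L[ℝ] W) (x : Q) : HomTangent E Q W := ⟨x, β x⟩

/-- The base point is unchanged, so both covectors are read in the same frame and smooth coordinates
are subtracted. -/
theorem contMDiff_sub_covectorSection {β : Q → E →L[ℝ] W}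
    (hβ : ContMDiff 𝓘(ℝ, E) (𝓘(ℝ, E).prod 𝓘(ℝ, E →L[ℝ] W)) ∞ (covectorSection β)) :
    ContMDiff (𝓘(ℝ, E).prod 𝓘(ℝ, E →L[ℝ] W)) (𝓘(ℝ, E).prod 𝓘(ℝ, E →L[ℝ] W)) ∞
      (fun α : HomTangent E Q W =>
        (⟨α.1, (show E →L[ℝ] W from α.2) - β α.1⟩ : HomTangent E Q W)) := by
  intro α
  obtain ⟨h1, h2⟩ := contMDiffAt_homTangent.1 (contMDiffAt_id (x := α)
    (I := (𝓘(ℝ, E).prod 𝓘(ℝ, E →L[ℝ] W))) (n := ∞))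
  obtain ⟨-, h3⟩ := contMDiffAt_homTangent.1 (hβ α.1)
  refine contMDiffAt_homTangent.2 ⟨h1, ?_⟩
  have h4 := ContMDiffAt.comp α h3 h1
  exact h2.sub h4

theorem contMDiff_comp_covectorSection {W' : Type*} [NormedAddCommGroup W'] [NormedSpace ℝ W']
    {β : Q → E →L[ℝ] W} {m : Q → W →L[ℝ] W'}
    (hβ : ContMDiff 𝓘(ℝ, E) (𝓘(ℝ, E).prod 𝓘(ℝ, E →L[ℝ] W)) ∞ (covectorSection β))
    (hm : ContMDiff 𝓘(ℝ, E) 𝓘(ℝ, W →L[ℝ] W') ∞ m) :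
    ContMDiff 𝓘(ℝ, E) (𝓘(ℝ, E).prod 𝓘(ℝ, E →L[ℝ] W')) ∞
      (covectorSection fun x => (m x).comp (β x)) := by
  intro x
  obtain ⟨h1, h2⟩ := contMDiffAt_homTangent.1 (hβ x)
  exact contMDiffAt_homTangent.2 ⟨h1, (hm x).clm_comp h2⟩

theorem contMDiff_cotangentProj : ContMDiff (cotangentModel E) 𝓘(ℝ, E) ∞
    (cotangentProj : Cotangent E Q → Q) :=
  contMDiff_proj _

end CotangentMaps

/-! ### Smoothness of the lifted action -/

section CotangentAction

variable {E : Type*} [NormedAddCommGroup E] [NormedSpace ℝ E] [FiniteDimensional ℝ E]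
  {Q : Type*} [TopologicalSpace Q] [ChartedSpace E Q] [IsManifold 𝓘(ℝ, E) ∞ Q]
  {V : Type*} [NormedAddCommGroup V] [NormedSpace ℝ V]
  {F : Type*} [TopologicalSpace F] [ChartedSpace V F] [Group F] [LieGroup 𝓘(ℝ, V) ∞ F]
  [MulAction F Q] [ContMDiffSMul 𝓘(ℝ, V) 𝓘(ℝ, E) ∞ F Q]

/-- The fibre part composes the covector with the derivative of y ↦ h⁻¹ • y, which depends smoothly
on h and on the base point. In local coordinates a frame follows a coframe over the same point, and
they cancel. -/
theorem contMDiff_cotangentLift : ContMDiff (𝓘(ℝ, V).prod (cotangentModel E)) (cotangentModel E) ∞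
    (fun p : F × Cotangent E Q => cotangentLift p.1 p.2) := by
  intro p
  have hb : ContMDiff (𝓘(ℝ, V).prod (cotangentModel E)) 𝓘(ℝ, E) ∞
      (fun p : F × Cotangent E Q => p.1 • p.2.1) :=
    (ContMDiffSMul.contMDiff_smul (I := 𝓘(ℝ, V)) (I' := 𝓘(ℝ, E)) (n := ∞) (G := F) (M := Q)).comp
      (contMDiff_fst.prodMk (contMDiff_cotangentProj.comp contMDiff_snd))
  refine contMDiffAt_homTangent.2 ⟨hb p, ?_⟩
  have hf : ContMDiffAt ((𝓘(ℝ, V).prod (cotangentModel E)).prod 𝓘(ℝ, E)) 𝓘(ℝ, E) ∞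
      (Function.uncurry fun (p : F × Cotangent E Q) (y : Q) => p.1⁻¹ • y) (p, p.1 • p.2.1) := by
    refine ContMDiff.contMDiffAt ?_
    exact (ContMDiffSMul.contMDiff_smul (I := 𝓘(ℝ, V)) (I' := 𝓘(ℝ, E)) (n := ∞)
      (G := F) (M := Q)).comp (((contMDiff_inv 𝓘(ℝ, V) ∞).comp
        (contMDiff_fst.comp contMDiff_fst)).prodMk contMDiff_snd)
  have hD := ContMDiffAt.mfderiv (fun (p : F × Cotangent E Q) (y : Q) => p.1⁻¹ • y)
    (fun p => p.1 • p.2.1) hf (hb p) (m := ∞) le_rfl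
  have hg : (fun x : F × Cotangent E Q => x.1⁻¹ • x.1 • x.2.1) = fun x => x.2.1 := by
    funext x
    exact inv_smul_smul _ _
  rw [hg] at hD
  obtain ⟨-, h2⟩ := contMDiffAt_homTangent.1 ((contMDiff_snd (I := 𝓘(ℝ, V))
    (J := cotangentModel E) (M := F) (N := Cotangent E Q) (n := ∞)) p)
  have h3 := h2.clm_comp hD
  refine h3.congr_of_eventuallyEq ?_
  have hs : ∀ᶠ q : F × Cotangent E Q in 𝓝 p,
      q.2.1 ∈ (trivializationAt E (TangentSpace 𝓘(ℝ, E)) p.2.1).baseSet := by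
    refine (contMDiff_cotangentProj.continuous.comp continuous_snd).continuousAt.preimage_mem_nhds
      ((trivializationAt E (TangentSpace 𝓘(ℝ, E)) p.2.1).open_baseSet.mem_nhds ?_)
    exact FiberBundle.mem_baseSet_trivializationAt' (F := E) (E := TangentSpace 𝓘(ℝ, E)) p.2.1
  filter_upwards [hs] with q hq
  ext v
  let D : E →L[ℝ] E := mfderiv 𝓘(ℝ, E) 𝓘(ℝ, E) (fun y : Q => q.1⁻¹ • y) (q.1 • q.2.1)
  have hv := tangentFrame_tangentCoframe hq
    (D (tangentFrame (p.1 • p.2.1) (q.1 • q.2.1) v))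
  exact congrArg (show E →L[ℝ] ℝ from q.2.2) hv.symm
end CotangentAction

section Composition

variable {E : Type*} [NormedAddCommGroup E] [NormedSpace ℝ E]
  {H : Type*} [TopologicalSpace H] {I : ModelWithCorners ℝ E H}
  {M : Type*} [TopologicalSpace M] [ChartedSpace H M]
  {E' : Type*} [NormedAddCommGroup E'] [NormedSpace ℝ E']
  {H' : Type*} [TopologicalSpace H'] {I' : ModelWithCorners ℝ E' H'}
  {M' : Type*} [TopologicalSpace M'] [ChartedSpace H' M']
  {E'' : Type*} [NormedAddCommGroup E''] [NormedSpace ℝ E'']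
  {H'' : Type*} [TopologicalSpace H''] {I'' : ModelWithCorners ℝ E'' H''}
  {M'' : Type*} [TopologicalSpace M''] [ChartedSpace H'' M'']

/-- The base point is matched by a proved equality, as for orbit maps at 1, where the lift by 1
fixes α only by a theorem. -/
theorem hasMFDerivAt_comp_of_eq {g : M' → M''} {f : M → M'} {x : M} {y : M'}
    {g' : E' →L[ℝ] E''} {f' : E →L[ℝ] E'} (hg : HasMFDerivAt I' I'' g y g')
    (hf : HasMFDerivAt I I' f x f') (h : f x = y) :
    HasMFDerivAt I I'' (g ∘ f) x (g'.comp f' : E →L[ℝ] E'') := by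
  subst h
  exact hg.comp x hf

end Composition

/-! ### The momentum map and its components -/

section Momentum

variable {E : Type*} [NormedAddCommGroup E] [NormedSpace ℝ E] [FiniteDimensional ℝ E]
  {Q : Type*} [TopologicalSpace Q] [ChartedSpace E Q] [IsManifold 𝓘(ℝ, E) ∞ Q]
  {V : Type*} [NormedAddCommGroup V] [NormedSpace ℝ V] [FiniteDimensional ℝ V]
  {F : Type*} [TopologicalSpace F] [ChartedSpace V F] [Group F] [LieGroup 𝓘(ℝ, V) ∞ F]
  [MulAction F Q] [ContMDiffSMul 𝓘(ℝ, V) 𝓘(ℝ, E) ∞ F Q]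

/-- The projection intertwines the lifted action with the action on Q, so by the chain rule the
lifted generators project to those on Q. In particular the momentum is linear on fibres. -/
theorem momentumMap_eq (α : Cotangent E Q) : momentumMap V F α =
    ContinuousLinearMap.comp (show TangentSpace 𝓘(ℝ, E) α.1 →L[ℝ] ℝ from α.2)
      (generator E V F α.1) := by
  have h1 : HasMFDerivAt (cotangentModel E) 𝓘(ℝ, E) (cotangentProj : Cotangent E Q → Q) α
      (mfderiv (cotangentModel E) 𝓘(ℝ, E) (cotangentProj : Cotangent E Q → Q) α) :=
    ((contMDiff_cotangentProj α).mdifferentiableAt (by simp)).hasMFDerivAt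
  have h2 : HasMFDerivAt 𝓘(ℝ, V) (cotangentModel E) (fun g : F => cotangentLift g α) 1
      (mfderiv 𝓘(ℝ, V) (cotangentModel E) (fun g : F => cotangentLift g α) 1) := by
    have : ContMDiff 𝓘(ℝ, V) (cotangentModel E) ∞ (fun g : F => cotangentLift g α) :=
      contMDiff_cotangentLift.comp (contMDiff_id.prodMk contMDiff_const)
    exact ((this 1).mdifferentiableAt (by simp)).hasMFDerivAt
  have h3 := hasMFDerivAt_comp_of_eq h1 h2 (cotangentLift_one α)
  have h4 : generator E V F α.1 = ((mfderiv (cotangentModel E) 𝓘(ℝ, E)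
      (cotangentProj : Cotangent E Q → Q) α).comp (cotangentGenerator V F α)) := h3.mfderiv
  rw [h4]
  rfl

theorem gaugeMomentum_eq (η : Q → GroupLieAlgebra 𝓘(ℝ, V) F) (α : Cotangent E Q) :
    gaugeMomentum η α =
      (show TangentSpace 𝓘(ℝ, E) α.1 →L[ℝ] ℝ from α.2) (generator E V F α.1 (η α.1)) := by
  rw [gaugeMomentum, momentumMap_eq]
  rfl

theorem contMDiff_gaugeMomentum {η : Q → GroupLieAlgebra 𝓘(ℝ, V) F}
    (hη : ContMDiff 𝓘(ℝ, E) 𝓘(ℝ, V) ∞ (M' := V) η) :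
    ContMDiff (cotangentModel E) 𝓘(ℝ, ℝ) ∞ (gaugeMomentum η : Cotangent E Q → ℝ) := by
  intro α
  have hf : ContMDiffAt ((cotangentModel E).prod 𝓘(ℝ, V)) 𝓘(ℝ, E) ∞
      (Function.uncurry fun (α : Cotangent E Q) (g : F) => g • α.1) (α, 1) := by
    refine ContMDiff.contMDiffAt ?_
    exact (ContMDiffSMul.contMDiff_smul (I := 𝓘(ℝ, V)) (I' := 𝓘(ℝ, E)) (n := ∞)
      (G := F) (M := Q)).comp (contMDiff_snd.prodMk (contMDiff_cotangentProj.comp contMDiff_fst))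
  have hD := ContMDiffAt.mfderiv (fun (α : Cotangent E Q) (g : F) => g • α.1)
    (fun _ => 1) hf contMDiffAt_const (m := ∞) le_rfl
  have hg : (fun α : Cotangent E Q => (1 : F) • α.1) = fun α => α.1 := by
    funext x
    exact one_smul _ _
  rw [hg] at hD
  obtain ⟨-, h2⟩ := contMDiffAt_homTangent.1 (contMDiffAt_id (x := α)
    (I := cotangentModel E) (n := ∞))
  -- The smooth derivative in `hD` is read through the frame of the group at 1; `B` compensates for
  -- that frame.
  let B : V →L[ℝ] V := tangentCoframe (1 : F) (1 : F)
  have hηB : ContMDiffAt (cotangentModel E) 𝓘(ℝ, V) ∞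
      (fun α : Cotangent E Q => B (η α.1)) α :=
    B.contDiff.contMDiff.contMDiffAt.comp α ((hη α.1).comp α (contMDiff_cotangentProj α))
  refine (h2.clm_apply (hD.clm_apply hηB)).congr_of_eventuallyEq ?_
  have hs : ∀ᶠ q : Cotangent E Q in 𝓝 α,
      q.1 ∈ (trivializationAt E (TangentSpace 𝓘(ℝ, E)) α.1).baseSet := by
    refine contMDiff_cotangentProj.continuous.continuousAt.preimage_mem_nhds
      ((trivializationAt E (TangentSpace 𝓘(ℝ, E)) α.1).open_baseSet.mem_nhds ?_)
    exact FiberBundle.mem_baseSet_trivializationAt' (F := E) (E := TangentSpace 𝓘(ℝ, E)) α.1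
  filter_upwards [hs] with q hq
  rw [gaugeMomentum_eq]
  let D : V →L[ℝ] E := generator E V F q.1
  have h1 : tangentFrame (1 : F) (1 : F) (B (η q.1)) = η q.1 := tangentFrame_tangentCoframe
    (FiberBundle.mem_baseSet_trivializationAt' (F := V) (E := TangentSpace 𝓘(ℝ, V)) (1 : F)) _
  have h5 := tangentFrame_tangentCoframe hq (D (tangentFrame (1 : F) (1 : F) (B (η q.1))))
  refine Eq.trans ?_ (congrArg (show E →L[ℝ] ℝ from q.2) h5.symm)
  exact congrArg (fun v : V => (show E →L[ℝ] ℝ from q.2) (D v)) h1.symm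

theorem contMDiff_fibreInclusion (x : Q) : ContMDiff 𝓘(ℝ, E →L[ℝ] ℝ) (cotangentModel E) ∞
    (fun a : E →L[ℝ] ℝ => (⟨x, a⟩ : Cotangent E Q)) := by
  intro a
  refine contMDiffAt_homTangent.2 ⟨contMDiffAt_const, ?_⟩
  exact ((contMDiffAt_id (x := a)).clm_comp
    (contMDiffAt_const (c := (tangentFrame x x : E →L[ℝ] E))))

/-- Along the fibre through α the map is affine with linear part `T`, so vertical directions alone
already fill the target. -/
theorem surjective_mfderiv_of_fibre {k : ℕ} {G : Cotangent E Q → (Fin k → ℝ)}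
    (hG : ContMDiff (cotangentModel E) 𝓘(ℝ, Fin k → ℝ) ∞ G) (α : Cotangent E Q)
    (T : (E →L[ℝ] ℝ) →L[ℝ] (Fin k → ℝ)) (hT : Function.Surjective T) (c : Fin k → ℝ)
    (hGT : ∀ a : E →L[ℝ] ℝ, G ⟨α.1, a⟩ = T a - c) :
    Function.Surjective (mfderiv (cotangentModel E) 𝓘(ℝ, Fin k → ℝ) G α) := by
  have h1 : HasMFDerivAt (cotangentModel E) 𝓘(ℝ, Fin k → ℝ) G α
      (mfderiv (cotangentModel E) 𝓘(ℝ, Fin k → ℝ) G α) :=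
    ((hG α).mdifferentiableAt (by simp)).hasMFDerivAt
  let p : E →L[ℝ] ℝ := α.2
  have h2 := (((contMDiff_fibreInclusion α.1) p).mdifferentiableAt (by simp)).hasMFDerivAt
  have h3 := (hasMFDerivAt_comp_of_eq h1 h2 rfl).hasFDerivAt
  have h4 : HasFDerivAt (G ∘ fun a : E →L[ℝ] ℝ => (⟨α.1, a⟩ : Cotangent E Q)) T α.2 := by
    have : (G ∘ fun a : E →L[ℝ] ℝ => (⟨α.1, a⟩ : Cotangent E Q)) = fun a => T a - c := by
      funext a
      exact hGT a
    rw [this]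
    exact T.hasFDerivAt.sub_const c
  have h5 := HasFDerivAt.unique (𝕜 := ℝ) (E := E →L[ℝ] ℝ) (F := Fin k → ℝ) h3 h4
  intro t
  obtain ⟨a, ha⟩ := hT t
  exact ⟨_, (congrArg (fun S : (E →L[ℝ] ℝ) →L[ℝ] (Fin k → ℝ) => S a) h5).trans ha⟩

end Momentum

/-! ### Smoothness of one-forms and of the Liouville form -/

section OneForms

/-- Covectors as alternating `1`-forms, as a continuous linear map. -/
def oneFormL (X : Type*) [NormedAddCommGroup X] [NormedSpace ℝ X] [FiniteDimensional ℝ X] :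
    (X →L[ℝ] ℝ) →L[ℝ] X [⋀^Fin 1]→L[ℝ] ℝ :=
  LinearMap.toContinuousLinearMap
    { toFun := ContinuousAlternatingMap.ofSubsingleton ℝ X ℝ (0 : Fin 1)
      map_add' := fun _ _ => rfl
      map_smul' := fun _ _ => rfl }

variable {X : Type*} [NormedAddCommGroup X] [NormedSpace ℝ X] [FiniteDimensional ℝ X]
  {H : Type*} [TopologicalSpace H] {I : ModelWithCorners ℝ X H} [I.Boundaryless]
  {M : Type*} [TopologicalSpace M] [ChartedSpace H M] [IsManifold I ∞ M]
  {X' : Type*} [NormedAddCommGroup X'] [NormedSpace ℝ X'] [FiniteDimensional ℝ X']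
  {H' : Type*} [TopologicalSpace H'] {I' : ModelWithCorners ℝ X' H'} [I'.Boundaryless]
  {M' : Type*} [TopologicalSpace M'] [ChartedSpace H' M'] [IsManifold I' ∞ M']

theorem localForm_oneForm (θ : ∀ x : M, TangentSpace I x →L[ℝ] ℝ) (x : M) (y : X) :
    localForm (oneForm θ) x y = oneFormL X (ContinuousLinearMap.comp
      (show X →L[ℝ] ℝ from θ ((extChartAt I x).symm y))
      (mfderiv 𝓘(ℝ, X) I (extChartAt I x).symm y : X →L[ℝ] X)) := rfl

theorem differentiableAt_localForm_smul {n : ℕ} (c : ℝ) {θ : DForm I M n} {x : M}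
    (h : DifferentiableAt ℝ (localForm θ x) (extChartAt I x x)) :
    DifferentiableAt ℝ (localForm (c • θ) x) (extChartAt I x x) := by
  rw [localForm_smul]
  exact h.const_smul c

variable {E : Type*} [NormedAddCommGroup E] [NormedSpace ℝ E] [FiniteDimensional ℝ E]
  {Q : Type*} [TopologicalSpace Q] [ChartedSpace E Q] [IsManifold 𝓘(ℝ, E) ∞ Q]

/-- The pull-back of the canonical `1`-form along a smooth map into `T^*Q` is smooth. -/
theorem contDiffAt_comp_mfderiv {f : X → Cotangent E Q} {p : X}
    (hf : ContMDiffAt 𝓘(ℝ, X) (cotangentModel E) ∞ f p) :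
    ContDiffAt ℝ ∞ (fun y => ContinuousLinearMap.comp (show E →L[ℝ] ℝ from (f y).2)
      (show X →L[ℝ] E from mfderiv 𝓘(ℝ, X) 𝓘(ℝ, E) (fun z => (f z).1) y)) p := by
  obtain ⟨h1, h2⟩ := contMDiffAt_homTangent.1 hf
  have h3 := ContMDiffAt.mfderiv_const h1 (m := ∞) le_rfl
  refine contMDiffAt_iff_contDiffAt.1 ((h2.clm_comp h3).congr_of_eventuallyEq ?_)
  have hs : ∀ᶠ q : X in 𝓝 p,
      (f q).1 ∈ (trivializationAt E (TangentSpace 𝓘(ℝ, E)) (f p).1).baseSet := by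
    refine h1.continuousAt.preimage_mem_nhds
      ((trivializationAt E (TangentSpace 𝓘(ℝ, E)) (f p).1).open_baseSet.mem_nhds ?_)
    exact FiberBundle.mem_baseSet_trivializationAt' (F := E) (E := TangentSpace 𝓘(ℝ, E)) (f p).1
  filter_upwards [hs] with q hq
  ext v
  let D : X →L[ℝ] E := mfderiv 𝓘(ℝ, X) 𝓘(ℝ, E) (fun z => (f z).1) q
  have hm : tangentFrame p q v = v :=
    congrArg (fun S : X →L[ℝ] X => S v) (TangentBundle.symmL_model_space p q)
  have h5 := tangentFrame_tangentCoframe hq (D (tangentFrame p q v))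
  refine Eq.trans ?_ (congrArg (show E →L[ℝ] ℝ from (f q).2) h5.symm)
  exact congrArg (fun v : X => (show E →L[ℝ] ℝ from (f q).2) (D v)) hm.symm

theorem differentiableAt_localForm_oneForm {β : Q → E →L[ℝ] ℝ}
    (hβ : ContMDiff 𝓘(ℝ, E) (𝓘(ℝ, E).prod 𝓘(ℝ, E →L[ℝ] ℝ)) ∞ (covectorSection β)) (x : Q) :
    DifferentiableAt ℝ (localForm (I := 𝓘(ℝ, E)) (oneForm β) x) (extChartAt 𝓘(ℝ, E) x x) := by
  have h1 : ContMDiffAt 𝓘(ℝ, E) 𝓘(ℝ, E) ∞ (extChartAt 𝓘(ℝ, E) x).symm (extChartAt 𝓘(ℝ, E) x x) :=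
    (contMDiffOn_extChartAt_symm x).contMDiffAt (extChartAt_target_mem_nhds x)
  have h2 := contDiffAt_comp_mfderiv ((hβ _).comp _ h1)
  exact (oneFormL E).differentiableAt.comp _ (h2.differentiableAt (by simp))

/-- The inverse chart is itself a smooth map into T^*Q, and the local expression of Θ at y is the
covector φ⁻¹(y) composed with the derivative of τ ∘ φ⁻¹. -/
theorem differentiableAt_localForm_liouville (α : Cotangent E Q) :
    DifferentiableAt ℝ (localForm (oneForm liouville) α) (extChartAt (cotangentModel E) α α) := by
  have h1 : ContMDiffAt 𝓘(ℝ, E × (E →L[ℝ] ℝ)) (cotangentModel E) ∞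
      (extChartAt (cotangentModel E) α).symm (extChartAt (cotangentModel E) α α) :=
    (contMDiffOn_extChartAt_symm α).contMDiffAt (extChartAt_target_mem_nhds α)
  have h2 := contDiffAt_comp_mfderiv h1
  have h0 := DifferentiableAt.comp (G := (E × (E →L[ℝ] ℝ)) [⋀^Fin 1]→L[ℝ] ℝ) _
    (oneFormL (E × (E →L[ℝ] ℝ))).differentiableAt (h2.differentiableAt (by simp))
  refine h0.congr_of_eventuallyEq ?_
  filter_upwards [extChartAt_target_mem_nhds (I := cotangentModel E) α] with y hy
  rw [localForm_oneForm]
  refine congrArg (oneFormL (E × (E →L[ℝ] ℝ))) ?_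
  have h3 := mdifferentiableAt_extChartAt_symm (I := cotangentModel E) hy
  have h4 := HasMFDerivAt.comp y ((contMDiff_cotangentProj (E := E) (Q := Q) _).mdifferentiableAt
    (by simp)).hasMFDerivAt h3.hasMFDerivAt
  have h5 := h4.mfderiv
  refine Eq.trans ?_ (congrArg (fun D : E × (E →L[ℝ] ℝ) →L[ℝ] E => ContinuousLinearMap.comp
    (show E →L[ℝ] ℝ from ((extChartAt (cotangentModel E) α).symm y).2) D) h5.symm)
  rfl

end OneForms

/-! ### Effect of a fibre translation on the canonical forms -/

section ShiftForms

variable {E : Type*} [NormedAddCommGroup E] [NormedSpace ℝ E] [FiniteDimensional ℝ E]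
  {Q : Type*} [TopologicalSpace Q] [ChartedSpace E Q] [IsManifold 𝓘(ℝ, E) ∞ Q]

/-- Translation of covectors by a `1`-form. -/
def subCovector (β : Q → E →L[ℝ] ℝ) (α : Cotangent E Q) : Cotangent E Q :=
  ⟨α.1, (show E →L[ℝ] ℝ from α.2) - β α.1⟩

theorem contMDiff_subCovector {β : Q → E →L[ℝ] ℝ}
    (hβ : ContMDiff 𝓘(ℝ, E) (𝓘(ℝ, E).prod 𝓘(ℝ, E →L[ℝ] ℝ)) ∞ (covectorSection β)) :
    ContMDiff (cotangentModel E) (cotangentModel E) ∞ (subCovector β) :=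
  contMDiff_sub_covectorSection hβ

/-- Translation covers the identity of Q, so its tangent map does not change Tτ(v); only the
covector evaluated on it changes, by β. -/
theorem pullbackForm_subCovector_liouville {β : Q → E →L[ℝ] ℝ}
    (hβ : ContMDiff 𝓘(ℝ, E) (𝓘(ℝ, E).prod 𝓘(ℝ, E →L[ℝ] ℝ)) ∞ (covectorSection β)) :
    pullbackForm (I := cotangentModel E) (subCovector β) (oneForm liouville) =
      oneForm (liouville (E := E) (Q := Q)) +
        (-1 : ℝ) • pullbackForm cotangentProj (oneForm (I := 𝓘(ℝ, E)) β) := by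
  funext α
  have h1 : HasMFDerivAt (cotangentModel E) (cotangentModel E) (subCovector β) α _ :=
    ((contMDiff_subCovector hβ α).mdifferentiableAt (by simp)).hasMFDerivAt
  have h2 : HasMFDerivAt (cotangentModel E) 𝓘(ℝ, E) (cotangentProj : Cotangent E Q → Q)
    (subCovector β α) _ := ((contMDiff_cotangentProj _).mdifferentiableAt (by simp)).hasMFDerivAt
  have h3 := (HasMFDerivAt.comp α h2 h1).mfderiv
  let P : E × (E →L[ℝ] ℝ) →L[ℝ] E := mfderiv (cotangentModel E) 𝓘(ℝ, E)
    (cotangentProj : Cotangent E Q → Q) α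
  have h4 : P = _ := h3
  ext v
  have h5 := congrArg (fun D : E × (E →L[ℝ] ℝ) →L[ℝ] E =>
    ((show E →L[ℝ] ℝ from α.2) - β α.1) (D (v 0))) h4
  refine Eq.trans h5.symm ?_
  change (show E →L[ℝ] ℝ from α.2) (P (v 0)) - β α.1 (P (v 0)) =
    (show E →L[ℝ] ℝ from α.2) (P (v 0)) + (-1 : ℝ) • β α.1 (P (v 0))
  simp [sub_eq_add_neg]

/-- Apply -d to the formula for Θ: the sign in Ω = -dΘ turns the subtraction of β into the addition
of dβ. -/
theorem pullbackForm_subCovector_canonicalForm {β : Q → E →L[ℝ] ℝ}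
    (hβ : ContMDiff 𝓘(ℝ, E) (𝓘(ℝ, E).prod 𝓘(ℝ, E →L[ℝ] ℝ)) ∞ (covectorSection β)) :
    pullbackForm (subCovector β) (canonicalForm E Q) =
      canonicalForm E Q + pullbackForm cotangentProj (dForm (oneForm (I := 𝓘(ℝ, E)) β)) := by
  funext α
  have h1 := dForm_pullbackForm (contMDiff_subCovector hβ) (oneForm liouville) α
    (differentiableAt_localForm_liouville _)
  have h2 := dForm_pullbackForm contMDiff_cotangentProj (oneForm (I := 𝓘(ℝ, E)) β) α
    (differentiableAt_localForm_oneForm hβ _)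
  have h3 := differentiableAt_localForm_pullbackForm contMDiff_cotangentProj
    (oneForm (I := 𝓘(ℝ, E)) β) α (differentiableAt_localForm_oneForm hβ _)
  have h5 := differentiableAt_localForm_smul (-1) h3
  rw [pullbackForm_subCovector_liouville hβ, dForm_add (differentiableAt_localForm_liouville _)
    h5, dForm_smul, h2] at h1
  have h4 : pullbackForm (I := cotangentModel E) (subCovector β) (canonicalForm E Q) α =
      -pullbackForm (I := cotangentModel E) (subCovector β) (dForm (oneForm liouville)) α := rfl
  have h6 : ∀ a b : TangentSpace (cotangentModel E) α [⋀^Fin 2]→L[ℝ] ℝ,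
      -(a + (-1 : ℝ) • b) = -a + b := fun a b => by
    ext v
    simp [add_comm]
  rw [h4, ← h1]
  exact h6 _ _

end ShiftForms

/-! ### Invariant submanifolds and their orbit spaces -/

section Submanifolds

variable {E : Type*} [NormedAddCommGroup E] [NormedSpace ℝ E]
  {H : Type*} [TopologicalSpace H] {I : ModelWithCorners ℝ E H}
  {M : Type*} [TopologicalSpace M] [ChartedSpace H M] [IsManifold I ∞ M]
  {EN : Type*} [NormedAddCommGroup EN] [NormedSpace ℝ EN]
  {HN : Type*} [TopologicalSpace HN] {J : ModelWithCorners ℝ EN HN}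
  {N : Type*} [TopologicalSpace N] [ChartedSpace HN N] [IsManifold J ∞ N]

theorem SubmanifoldStructure.contMDiff_val {L : Set M} (S : SubmanifoldStructure I L) :
    ContMDiff (𝓡 S.dim) I ∞ (Subtype.val : L → M) :=
  S.isSmoothEmbedding.isImmersion.contMDiff

theorem SubmanifoldStructure.contMDiff_of_val {L : Set M} (S : SubmanifoldStructure I L)
    {f : N → L} (hf : ContMDiff J I ∞ fun x => (f x : M)) : ContMDiff J (𝓡 S.dim) ∞ f :=
  (ContMDiff.iff_comp_isImmersion S.isSmoothEmbedding.isImmersion).2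
    ⟨hf.continuous.subtype_mk fun x => (f x).2, hf⟩

end Submanifolds

section InvariantSubmanifolds

variable {E : Type*} [NormedAddCommGroup E] [NormedSpace ℝ E] [FiniteDimensional ℝ E]
  {Q : Type*} [TopologicalSpace Q] [ChartedSpace E Q] [IsManifold 𝓘(ℝ, E) ∞ Q]
  {V : Type*} [NormedAddCommGroup V] [NormedSpace ℝ V] [FiniteDimensional ℝ V]
  {F : Type*} [TopologicalSpace F] [ChartedSpace V F] [Group F] [LieGroup 𝓘(ℝ, V) ∞ F]
  [MulAction F Q] [ContMDiffSMul 𝓘(ℝ, V) 𝓘(ℝ, E) ∞ F Q]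

variable (V) in
/-- The lifted action on an invariant subset of the cotangent bundle. -/
abbrev invariantAction {L : Set (Cotangent E Q)}
    (hinv : ∀ h : F, ∀ α ∈ L, cotangentLift h α ∈ L) : MulAction F L where
  smul h α := ⟨cotangentLift h α.1, hinv h α.1 α.2⟩
  one_smul α := Subtype.ext (cotangentLift_one α.1)
  mul_smul g h α := Subtype.ext (cotangentLift_mul V g h α.1)

/-- The quotient of an invariant submanifold of the cotangent bundle by the lift of a free and
proper action is a manifold. -/
theorem nonempty_quotientManifoldStructure_orbitSetoid [T2Space Q] [SecondCountableTopology Q]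
    [ProperSMul F Q] (hfree : ∀ (h : F) (x : Q), h • x = x → h = 1)
    (hgen : ∀ x : Q, Function.Injective (generator E V F x))
    {L : Set (Cotangent E Q)} (hinv : ∀ h : F, ∀ α ∈ L, cotangentLift h α ∈ L)
    (S : SubmanifoldStructure (cotangentModel E) L) :
    Nonempty (QuotientManifoldStructure (𝓡 S.dim) (orbitSetoid V F L)) := by
  let _ : MulAction F L := invariantAction V hinv
  have : T2Space (Cotangent E Q) := FiberBundle.t2Space_totalSpace
  have : SecondCountableTopology (Cotangent E Q) :=
    FiberBundle.secondCountableTopology_totalSpace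
  have hsmul : ContMDiff (𝓘(ℝ, V).prod (𝓡 S.dim)) (𝓡 S.dim) ∞ (fun p : F × L => p.1 • p.2) :=
    S.contMDiff_of_val (contMDiff_cotangentLift.comp
      (contMDiff_fst.prodMk (S.contMDiff_val.comp contMDiff_snd)))
  have : ContMDiffSMul 𝓘(ℝ, V) (𝓡 S.dim) ∞ F L := ⟨hsmul⟩
  have hb : ContMDiff (𝓡 S.dim) 𝓘(ℝ, E) ∞ (fun α : L => α.1.1) :=
    contMDiff_cotangentProj.comp S.contMDiff_val
  have : ProperSMul F L := by
    -- The projection to Q is continuous and equivariant, so convergence upstairs gives convergence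
    -- downstairs; properness on Q then supplies the limit of the group component.
    refine properSMul_iff_continuousSMul_ultrafilter_tendsto_t2.2
      ⟨⟨hsmul.continuous⟩, fun 𝒰 α₁ α₂ h => ?_⟩
    have h1 := (properSMul_iff_continuousSMul_ultrafilter_tendsto_t2.1 ‹ProperSMul F Q›).2
      (𝒰.map fun p : F × L => (p.1, p.2.1.1)) α₁.1.1 α₂.1.1
    obtain ⟨g, hg⟩ := h1 (by
      rw [Ultrafilter.coe_map, Filter.tendsto_map'_iff]
      exact ((hb.continuous.prodMap hb.continuous).tendsto (α₁, α₂)).comp h)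
    rw [Ultrafilter.coe_map, Filter.tendsto_map'_iff] at hg
    exact ⟨g, hg⟩
  have hmain : Nonempty (QuotientManifoldStructure (𝓡 S.dim) (MulAction.orbitRel F L)) := by
    refine nonempty_quotientManifoldStructure_orbitRel (V := V) (fun h α hα => ?_) fun α => ?_
    · exact hfree h α.1.1 (congrArg (fun β : L => β.1.1) hα)
    · have h1 : ContMDiff 𝓘(ℝ, V) (𝓡 S.dim) ∞ (fun g : F => g • α) :=
        hsmul.comp (contMDiff_id.prodMk contMDiff_const)
      -- Generators on `L` project to the generators on Q, so they inherit injectivity.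
      have h2 := hasMFDerivAt_comp_of_eq ((hb α).mdifferentiableAt (by simp)).hasMFDerivAt
        ((h1 1).mdifferentiableAt (by simp)).hasMFDerivAt (one_smul F α)
      have h3 : (generator E V F α.1.1 : V →L[ℝ] E) = _ := h2.mfderiv
      intro v w hvw
      refine hgen α.1.1 ?_
      refine (congrArg (fun D : V →L[ℝ] E => D v) h3).trans
        (Eq.trans ?_ (congrArg (fun D : V →L[ℝ] E => D w) h3).symm)
      exact congrArg (mfderiv (𝓡 S.dim) 𝓘(ℝ, E) (fun α : L => α.1.1) α) hvw
  -- The two relations put the group element on opposite sides, hence the appeals to symmetry.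
  have heq : orbitSetoid V F L = MulAction.orbitRel F L := by
    refine Setoid.ext fun α β => ⟨?_, ?_⟩
    · rintro ⟨h, hh⟩
      refine (MulAction.orbitRel F L).symm ?_
      exact ⟨h, Subtype.ext hh⟩
    · rintro ⟨h, hh⟩
      exact (orbitSetoid V F L).symm ⟨h, congrArg Subtype.val hh⟩
  rw [heq]
  exact hmain

end InvariantSubmanifolds

/-! ### Descent of diffeomorphisms to quotients -/

section Descent

variable {E : Type*} [NormedAddCommGroup E] [NormedSpace ℝ E]
  {H : Type*} [TopologicalSpace H] {I : ModelWithCorners ℝ E H} [I.Boundaryless]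
  {M : Type*} [TopologicalSpace M] [ChartedSpace H M] [IsManifold I ∞ M]
  {E' : Type*} [NormedAddCommGroup E'] [NormedSpace ℝ E']
  {H' : Type*} [TopologicalSpace H'] {I' : ModelWithCorners ℝ E' H'} [I'.Boundaryless]
  {M' : Type*} [TopologicalSpace M'] [ChartedSpace H' M'] [IsManifold I' ∞ M']

theorem QuotientManifoldStructure.contMDiff_mk {s : Setoid M}
    (T : QuotientManifoldStructure I s) : ContMDiff I (𝓡 T.dim) ∞ (Quotient.mk s) :=
  T.isSubmersion.contMDiff

/-- A diffeomorphism which identifies two equivalence relations descends to the quotients. -/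
theorem exists_diffeomorph_quotient (f : Diffeomorph I I' M M' ∞) {s : Setoid M} {s' : Setoid M'}
    (hs : ∀ x y, s x y ↔ s' (f x) (f y))
    (T : QuotientManifoldStructure I s) (T' : QuotientManifoldStructure I' s') :
    ∃ g : Diffeomorph (𝓡 T.dim) (𝓡 T'.dim) (Quotient s) (Quotient s') ∞,
      ∀ x, g (Quotient.mk s x) = Quotient.mk s' (f x) := by
  have hinv : ∀ x y, s' x y → s (f.symm x) (f.symm y) := fun x y h => by
    rw [hs, f.apply_symm_apply, f.apply_symm_apply]
    exact h
  refine ⟨⟨⟨Quotient.map f fun x y h => (hs x y).1 h, Quotient.map f.symm fun x y h => hinv x y h,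
    ?_, ?_⟩, ?_, ?_⟩, fun x => rfl⟩
  · rintro ⟨x⟩
    exact congrArg (Quotient.mk s) (f.symm_apply_apply x)
  · rintro ⟨x⟩
    exact congrArg (Quotient.mk s') (f.apply_symm_apply x)
  · exact contMDiff_of_comp_isSubmersion T.isSubmersion Quotient.mk_surjective
      (T'.contMDiff_mk.comp f.contMDiff)
  · exact contMDiff_of_comp_isSubmersion T'.isSubmersion Quotient.mk_surjective
      (T.contMDiff_mk.comp f.symm.contMDiff)

end Descent

/-! ### Level sets and equivariance in terms of the frame -/

section GaugeMomenta

variable {E : Type*} [NormedAddCommGroup E] [NormedSpace ℝ E] [FiniteDimensional ℝ E]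
  {Q : Type*} [TopologicalSpace Q] [ChartedSpace E Q] [IsManifold 𝓘(ℝ, E) ∞ Q]
  {V : Type*} [NormedAddCommGroup V] [NormedSpace ℝ V] [FiniteDimensional ℝ V]
  {F : Type*} [TopologicalSpace F] [ChartedSpace V F] [Group F] [LieGroup 𝓘(ℝ, V) ∞ F]
  [MulAction F Q] [ContMDiffSMul 𝓘(ℝ, V) 𝓘(ℝ, E) ∞ F Q]
  {k : ℕ} {η : Fin k → Q → GroupLieAlgebra 𝓘(ℝ, V) F}

theorem eq_of_frame {X : Type*} [NormedAddCommGroup X] [NormedSpace ℝ X] {ι : Type*} {v : ι → V}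
    (hv : Submodule.span ℝ (Set.range v) = ⊤) {a b : V →L[ℝ] X} (h : ∀ i, a (v i) = b (v i)) :
    a = b :=
  ContinuousLinearMap.coe_injective (LinearMap.ext_on_range hv h)

theorem sum_dualFrame_apply {μ : Fin k → V →L[ℝ] ℝ} {v : Fin k → V}
    (h : ∀ i j, μ i (v j) = if i = j then 1 else 0) (t : Fin k → ℝ) (j : Fin k) :
    (∑ i, t i • μ i) (v j) = t j := by
  simp [h]

/-- A covector on the Lie algebra is determined by its values on a frame, and those of `m` are
constant; the moving level becomes a level of k scalar functions. -/
theorem momentumLevel_eq_gaugeMomentum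
    (hη_span : ∀ x, Submodule.span ℝ (Set.range fun i => η i x) = ⊤)
    {m : Q → GroupLieAlgebra 𝓘(ℝ, V) F →L[ℝ] ℝ} {d : Fin k → ℝ} (hm : ∀ i x, m x (η i x) = d i) :
    momentumLevel m = {α : Cotangent E Q | ∀ i, gaugeMomentum (η i) α = d i} := by
  ext α
  constructor
  · intro h i
    rw [← hm i α.1]
    exact congrArg (fun a : V →L[ℝ] ℝ => a (η i α.1)) h
  · intro h
    exact eq_of_frame (V := V) (hη_span α.1) fun i => (h i).trans (hm i α.1).symm

/-- Every value is regular: the connection form gives, for t in ℝ^k, the vertical covector (∑ t_i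
μ^i) ∘ A, whose pairings with the generators of the frame are the t_i. -/
theorem nonempty_submanifoldStructure_gaugeLevel (A : PrincipalConnection E Q V F)
    (hη_smooth : ∀ i, ContMDiff 𝓘(ℝ, E) 𝓘(ℝ, V) ∞ (M' := V) (η i))
    {μ : Fin k → Q → GroupLieAlgebra 𝓘(ℝ, V) F →L[ℝ] ℝ}
    (hμ : ∀ i j x, μ i x (η j x) = if i = j then 1 else 0) (d : Fin k → ℝ) :
    Nonempty (SubmanifoldStructure (cotangentModel E)
      {α : Cotangent E Q | ∀ i, gaugeMomentum (η i) α = d i}) := by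
  let G : Cotangent E Q → Fin k → ℝ := fun α i => gaugeMomentum (η i) α - d i
  have hG : ContMDiff (cotangentModel E) 𝓘(ℝ, Fin k → ℝ) ∞ G :=
    contMDiff_pi_space.2 fun i => (contMDiff_gaugeMomentum (hη_smooth i)).sub contMDiff_const
  have hset : {α : Cotangent E Q | ∀ i, gaugeMomentum (η i) α = d i} = {α | G α = 0} := by
    ext α
    refine ⟨fun h => funext fun i => sub_eq_zero.2 (h i), fun h i => sub_eq_zero.1 (congrFun h i)⟩
  rw [hset]
  refine nonempty_submanifoldStructure_of_regular hG fun α _ => ?_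
  let w : Fin k → E := fun i => generator E V F α.1 (η i α.1)
  refine surjective_mfderiv_of_fibre hG α
    (ContinuousLinearMap.pi fun i => ContinuousLinearMap.apply ℝ ℝ (w i)) (fun t => ?_) d
    fun a => ?_
  · let P : E →L[ℝ] V := A.form α.1
    have hP : ∀ i, P (w i) = η i α.1 := fun i => A.form_generator α.1 (η i α.1)
    refine ⟨(∑ i, t i • (show V →L[ℝ] ℝ from μ i α.1)).comp P, funext fun j => ?_⟩
    exact (congrArg (fun v : V =>
      (∑ i, t i • (show V →L[ℝ] ℝ from μ i α.1) : V →L[ℝ] ℝ) v) (hP j)).trans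
      (sum_dualFrame_apply (V := V) (fun i j => hμ i j α.1) t j)
  · funext i
    exact congrArg (fun r => r - d i) (gaugeMomentum_eq (η i) ⟨α.1, a⟩)

/-- The gauge momenta being invariant, the frame is equivariant. -/
theorem adjointAction_frame (A : PrincipalConnection E Q V F) {η : Q → GroupLieAlgebra 𝓘(ℝ, V) F}
    (hη_inv : ∀ (h : F) (α : Cotangent E Q),
      gaugeMomentum η (cotangentLift h α) = gaugeMomentum η α) (h : F) (x : Q) :
    adjointAction h⁻¹ (η (h • x)) = η x := by
  -- Invariance at all covectors over x equates their values on two tangent vectors, so the vectors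
  -- coincide; applying A, with its equivariance, transfers this to the Lie algebra.
  have hD : ∀ a : E →L[ℝ] ℝ, a ((mfderiv 𝓘(ℝ, E) 𝓘(ℝ, E) (fun y : Q => h⁻¹ • y) (h • x) : E →L[ℝ] E)
      (generator E V F (h • x) (η (h • x)))) = a (generator E V F x (η x)) := fun a => by
    have := hη_inv h ⟨x, a⟩
    rw [gaugeMomentum_eq, gaugeMomentum_eq] at this
    exact this
  have h1 : ((mfderiv 𝓘(ℝ, E) 𝓘(ℝ, E) (fun y : Q => h⁻¹ • y) (h • x) : E →L[ℝ] E)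
      (generator E V F (h • x) (η (h • x)))) = generator E V F x (η x) := by
    refine (SeparatingDual.eq_iff_forall_dual_eq (R := ℝ) (V := E)).2 hD
  have h2 := A.equivariant h⁻¹ (h • x) (generator E V F (h • x) (η (h • x)))
  rw [A.form_generator] at h2
  rw [← h2, inv_smul_smul]
  exact (congrArg (A.form x) h1).trans (A.form_generator x (η x))

/-- The equivariance of A and the coadjoint equivariance of `m` cancel, so the one-form ⟨m, A⟩ is
invariant and translation by it commutes with the lift. -/
theorem cotangentLift_shiftMap (A : PrincipalConnection E Q V F)
    {m : Q → GroupLieAlgebra 𝓘(ℝ, V) F →L[ℝ] ℝ}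
    (hm : ∀ (h : F) (x : Q) (v : GroupLieAlgebra 𝓘(ℝ, V) F),
      m x (adjointAction h⁻¹ v) = m (h • x) v) (h : F) (α : Cotangent E Q) :
    shiftMap A m (cotangentLift h α) = cotangentLift h (shiftMap A m α) := by
  refine cotangent_ext (E := E) rfl ?_
  obtain ⟨x, a⟩ := α
  let D : E →L[ℝ] E := mfderiv 𝓘(ℝ, E) 𝓘(ℝ, E) (fun y : Q => h⁻¹ • y) (h • x)
  have h1 : ∀ v : E, (m (h • x)) (A.form (h • x) v) = m x (A.form x (D v)) := fun v => by
    rw [← hm]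
    have h2 := A.equivariant h⁻¹ (h • x) v
    rw [← h2, inv_smul_smul]
    rfl
  ext v
  exact congrArg (fun r : ℝ => (show E →L[ℝ] ℝ from a) (D v) - r) (h1 v)

end GaugeMomenta

section RestrictedShift

variable {E : Type*} [NormedAddCommGroup E] [NormedSpace ℝ E] [FiniteDimensional ℝ E]
  {Q : Type*} [TopologicalSpace Q] [ChartedSpace E Q] [IsManifold 𝓘(ℝ, E) ∞ Q]

/-- The translation of covectors by a smooth `1`-form is a diffeomorphism. -/
def subCovectorDiffeomorph {β β' : Q → E →L[ℝ] ℝ}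
    (hβ : ContMDiff 𝓘(ℝ, E) (𝓘(ℝ, E).prod 𝓘(ℝ, E →L[ℝ] ℝ)) ∞ (covectorSection β))
    (hβ' : ContMDiff 𝓘(ℝ, E) (𝓘(ℝ, E).prod 𝓘(ℝ, E →L[ℝ] ℝ)) ∞ (covectorSection β'))
    (h : ∀ x, β' x = -β x) :
    Diffeomorph (cotangentModel E) (cotangentModel E) (Cotangent E Q) (Cotangent E Q) ∞ where
  toFun := subCovector β
  invFun := subCovector β'
  left_inv α := by
    refine cotangent_ext (E := E) rfl ?_
    change (show E →L[ℝ] ℝ from α.2) - β α.1 - β' α.1 = α.2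
    rw [h]
    exact sub_neg_eq_add _ (β α.1) ▸ sub_add_cancel _ _
  right_inv α := by
    refine cotangent_ext (E := E) rfl ?_
    change (show E →L[ℝ] ℝ from α.2) - β' α.1 - β α.1 = α.2
    rw [h]
    exact sub_neg_eq_add _ (β α.1) ▸ add_sub_cancel_right _ _
  contMDiff_toFun := contMDiff_subCovector hβ
  contMDiff_invFun := contMDiff_subCovector hβ'

variable {EM : Type*} [NormedAddCommGroup EM] [NormedSpace ℝ EM]
  {H : Type*} [TopologicalSpace H] {I : ModelWithCorners ℝ EM H}
  {M : Type*} [TopologicalSpace M] [ChartedSpace H M] [IsManifold I ∞ M]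

/-- The restriction of a diffeomorphism to embedded submanifolds. -/
def SubmanifoldStructure.diffeomorph {L L' : Set M} (S : SubmanifoldStructure I L)
    (S' : SubmanifoldStructure I L') (f : Diffeomorph I I M M ∞) (h : ∀ x, x ∈ L ↔ f x ∈ L') :
    Diffeomorph (𝓡 S.dim) (𝓡 S'.dim) L L' ∞ where
  toFun x := ⟨f x, (h x).1 x.2⟩
  invFun x := ⟨f.symm x, (h _).2 (by rw [f.apply_symm_apply]; exact x.2)⟩
  left_inv x := Subtype.ext (f.symm_apply_apply x.1)
  right_inv x := Subtype.ext (f.apply_symm_apply x.1)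
  contMDiff_toFun := S'.contMDiff_of_val (f.contMDiff.comp S.contMDiff_val)
  contMDiff_invFun := S.contMDiff_of_val (f.symm.contMDiff.comp S'.contMDiff_val)

end RestrictedShift

/-! ### The main theorem -/

theorem lemma4p2
    {E : Type*} [NormedAddCommGroup E] [NormedSpace ℝ E] [FiniteDimensional ℝ E]
    {Q : Type*} [TopologicalSpace Q] [T2Space Q] [SecondCountableTopology Q]
    [ChartedSpace E Q] [IsManifold 𝓘(ℝ, E) ∞ Q]
    {V : Type*} [NormedAddCommGroup V] [NormedSpace ℝ V] [FiniteDimensional ℝ V]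
    {F : Type*} [TopologicalSpace F] [ChartedSpace V F] [Group F] [LieGroup 𝓘(ℝ, V) ∞ F]
    [MulAction F Q] [ContMDiffSMul 𝓘(ℝ, V) 𝓘(ℝ, E) ∞ F Q] [ProperSMul F Q]
    (hfree : ∀ (h : F) (x : Q), h • x = x → h = 1)
    (A : PrincipalConnection E Q V F)
    {k : ℕ} (η : Fin k → Q → GroupLieAlgebra 𝓘(ℝ, V) F)
    (hη_smooth : ∀ i, ContMDiff 𝓘(ℝ, E) 𝓘(ℝ, V) ∞ (M' := V) (η i))
    (hη_indep : ∀ x, LinearIndependent ℝ (fun i => η i x))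
    (hη_span : ∀ x, Submodule.span ℝ (Set.range fun i => η i x) = ⊤)
    (hη_inv : ∀ (i : Fin k) (h : F) (α : Cotangent E Q),
      gaugeMomentum (η i) (cotangentLift h α) = gaugeMomentum (η i) α)
    (μ : Fin k → Q → GroupLieAlgebra 𝓘(ℝ, V) F →L[ℝ] ℝ)
    (hμ : ∀ i j x, μ i x (η j x) = if i = j then 1 else 0)
    (Y : Fin k → ∀ x : Q, TangentSpace 𝓘(ℝ, E) x →L[ℝ] ℝ)
    (hY_vert : ∀ i j x, Y i x (generator E V F x (η j x)) = if i = j then 1 else 0)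
    (hY_hor : ∀ i x v, A.form x v = 0 → Y i x v = 0)
    (c : Fin k → ℝ) (m : Q → GroupLieAlgebra 𝓘(ℝ, V) F →L[ℝ] ℝ)
    (hm : ∀ x, m x = ∑ i, c i • μ i x)
    (L L₀ : Set (Cotangent E Q)) (hL : L = momentumLevel m) (hL₀ : L₀ = momentumLevel (V := V) (F := F) 0) :
    -- the shift is a diffeomorphism of the cotangent bundle
    (∃ Φ : Diffeomorph (cotangentModel E) (cotangentModel E) (Cotangent E Q) (Cotangent E Q) ∞,
      ∀ α, Φ α = shiftMap A m α) ∧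
    -- (i) the pull-back of the canonical form
    pullbackForm (shiftMap A m) (canonicalForm E Q) =
      canonicalForm E Q + pullbackForm cotangentProj (∑ i, c i • dForm (oneForm (Y i))) ∧
    -- (ii) the level sets are invariant, they are submanifolds, and their quotients are manifolds
    (∀ (h : F), ∀ α ∈ L, cotangentLift h α ∈ L) ∧
    (∀ (h : F), ∀ α ∈ L₀, cotangentLift h α ∈ L₀) ∧
    Nonempty (SubmanifoldStructure (cotangentModel E) L) ∧
    Nonempty (SubmanifoldStructure (cotangentModel E) L₀) ∧
    ∀ (S : SubmanifoldStructure (cotangentModel E) L)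
      (S₀ : SubmanifoldStructure (cotangentModel E) L₀),
      Nonempty (QuotientManifoldStructure (𝓡 S.dim) (orbitSetoid V F L)) ∧
      Nonempty (QuotientManifoldStructure (𝓡 S₀.dim) (orbitSetoid V F L₀)) ∧
      -- the shift restricts to an equivariant diffeomorphism of the level sets
      ∃ shift : Diffeomorph (𝓡 S.dim) (𝓡 S₀.dim) L L₀ ∞,
        (∀ α : L, (shift α : Cotangent E Q) = shiftMap A m α) ∧
        (∀ (h : F) (α : L) (hα : cotangentLift h (α : Cotangent E Q) ∈ L),
          (shift ⟨cotangentLift h α, hα⟩ : Cotangent E Q) = cotangentLift h (shift α)) ∧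
        -- and descends to a diffeomorphism of the quotients
        ∀ (T : QuotientManifoldStructure (𝓡 S.dim) (orbitSetoid V F L))
          (T₀ : QuotientManifoldStructure (𝓡 S₀.dim) (orbitSetoid V F L₀)),
          ∃ shiftBar : Diffeomorph (𝓡 T.dim) (𝓡 T₀.dim)
              (Quotient (orbitSetoid V F L)) (Quotient (orbitSetoid V F L₀)) ∞,
            ∀ α : L, shiftBar (Quotient.mk (orbitSetoid V F L) α) =
              Quotient.mk (orbitSetoid V F L₀) (shift α) := by
  have hμs : ∀ i, ContMDiff 𝓘(ℝ, E) 𝓘(ℝ, V →L[ℝ] ℝ) ∞ (M' := V →L[ℝ] ℝ) (μ i) := fun i =>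
    contMDiff_dualBasis (V := V) hη_smooth hη_span hμ i
  have hms : ContMDiff 𝓘(ℝ, E) 𝓘(ℝ, V →L[ℝ] ℝ) ∞ (M' := V →L[ℝ] ℝ) m := by
    have : m = fun x => ∑ i, c i • (show V →L[ℝ] ℝ from μ i x) := funext hm
    rw [this]
    exact ContMDiff.sum fun i _ =>
      (c i • ContinuousLinearMap.id ℝ (V →L[ℝ] ℝ)).contDiff.contMDiff.comp (hμs i)
  have hmη : ∀ i x, m x (η i x) = c i := fun i x => by
    rw [hm x]
    exact sum_dualFrame_apply (V := V) (fun i j => hμ i j x) c i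
  let β : Q → E →L[ℝ] ℝ := fun x => (m x).comp (A.form x)
  have hβ : ContMDiff 𝓘(ℝ, E) (𝓘(ℝ, E).prod 𝓘(ℝ, E →L[ℝ] ℝ)) ∞ (covectorSection β) :=
    contMDiff_comp_covectorSection (W := V) A.smooth hms
  have hβ' : ContMDiff 𝓘(ℝ, E) (𝓘(ℝ, E).prod 𝓘(ℝ, E →L[ℝ] ℝ)) ∞
      (covectorSection fun x => -β x) :=
    contMDiff_comp_covectorSection (W := V) (m := fun x => -m x) A.smooth hms.neg
  let Φ := subCovectorDiffeomorph hβ hβ' fun _ => rfl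
  have hY : ∀ i x, (Y i x : E →L[ℝ] ℝ) = (μ i x).comp (A.form x) := fun i x => by
    let g : V →L[ℝ] E := generator E V F x
    let P : E →L[ℝ] V := A.form x
    let y : E →L[ℝ] ℝ := Y i x
    have h1 : y.comp g = μ i x :=
      eq_of_frame (V := V) (hη_span x) fun j => (hY_vert i j x).trans (hμ i j x).symm
    refine ContinuousLinearMap.ext fun v => ?_
    change E at v
    -- Removing from v the generator of its connection value leaves a horizontal vector, on which
    -- Y^i vanishes; what remains is vertical.
    have h2 : P (v - g (P v)) = 0 := by
      rw [map_sub]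
      exact sub_eq_zero.2 (A.form_generator x (P v)).symm
    have h3 : y (v - g (P v)) = 0 := hY_hor i x _ h2
    rw [map_sub, sub_eq_zero] at h3
    exact h3.trans (congrArg (fun a : V →L[ℝ] ℝ => a (P v)) h1)
  have hYs : ∀ i, ContMDiff 𝓘(ℝ, E) (𝓘(ℝ, E).prod 𝓘(ℝ, E →L[ℝ] ℝ)) ∞ (covectorSection (Y i)) :=
    fun i => by
      have : (Y i : Q → E →L[ℝ] ℝ) = fun x => (μ i x).comp (A.form x) := funext (hY i)
      rw [this]
      exact contMDiff_comp_covectorSection (W := V) A.smooth (hμs i)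
  have hβY : oneForm (I := 𝓘(ℝ, E)) β = ∑ i, c i • oneForm (Y i) := by
    funext x
    have h1 : β x = ∑ i, c i • (show E →L[ℝ] ℝ from Y i x) := by
      refine ContinuousLinearMap.ext fun v => ?_
      change (m x) (A.form x v) = _
      rw [hm x, sum_apply, sum_apply]
      exact Finset.sum_congr rfl fun i _ =>
        congrArg (fun a : E →L[ℝ] ℝ => c i • a v) (hY i x).symm
    rw [Finset.sum_apply]
    exact (congrArg (oneFormL E) h1).trans (map_sum (oneFormL E) _ _)
  have hdβ : dForm (oneForm (I := 𝓘(ℝ, E)) β) = ∑ i, c i • dForm (oneForm (Y i)) := by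
    funext x
    rw [hβY, (differentiableAt_localForm_sum _ fun i _ => differentiableAt_localForm_smul (c i)
      (differentiableAt_localForm_oneForm (hYs i) x)).2, Finset.sum_apply]
    exact Finset.sum_congr rfl fun i _ => dForm_smul (c i) _ x
  have hmem : ∀ α, α ∈ L ↔ ∀ i, gaugeMomentum (η i) α = c i := fun α => by
    rw [hL, momentumLevel_eq_gaugeMomentum hη_span hmη]
    rfl
  have hmem₀ : ∀ α, α ∈ L₀ ↔ ∀ i, gaugeMomentum (η i) α = 0 := fun α => by
    rw [hL₀, momentumLevel_eq_gaugeMomentum (d := fun _ => 0) hη_span fun _ _ => rfl]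
    rfl
  have hinv : ∀ (h : F), ∀ α ∈ L, cotangentLift h α ∈ L := fun h α hα =>
    (hmem _).2 fun i => (hη_inv i h α).trans ((hmem α).1 hα i)
  have hinv₀ : ∀ (h : F), ∀ α ∈ L₀, cotangentLift h α ∈ L₀ := fun h α hα =>
    (hmem₀ _).2 fun i => (hη_inv i h α).trans ((hmem₀ α).1 hα i)
  have hequi : ∀ (h : F) (α : Cotangent E Q), Φ (cotangentLift h α) = cotangentLift h (Φ α) := by
    refine cotangentLift_shiftMap A fun h x v => ?_
    let a : V →L[ℝ] ℝ := (m x).comp (adjointAction h⁻¹)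
    -- On the frame at h • x both sides equal c_i, since Ad of h⁻¹ carries it to the frame at x.
    have : a = m (h • x) := eq_of_frame (V := V) (hη_span (h • x)) fun i =>
      (congrArg (m x) (adjointAction_frame A (hη_inv i) h x)).trans
        ((hmη i x).trans (hmη i (h • x)).symm)
    exact congrArg (fun b : V →L[ℝ] ℝ => b v) this
  -- The subtracted form takes the value ⟨m, η_i⟩ = c_i on the generator of η_i, because A
  -- reproduces generators.
  have hJΦ : ∀ i α, gaugeMomentum (η i) (Φ α) = gaugeMomentum (η i) α - c i := fun i α => by
    rw [gaugeMomentum_eq, gaugeMomentum_eq, ← hmη i α.1]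
    exact congrArg (fun v : V => (show E →L[ℝ] ℝ from α.2) ((generator E V F α.1 : V →L[ℝ] E)
      (η i α.1)) - (m α.1 : V →L[ℝ] ℝ) v) (A.form_generator α.1 (η i α.1))
  have hΦL : ∀ α, α ∈ L ↔ Φ α ∈ L₀ := fun α => by
    rw [hmem, hmem₀]
    exact forall_congr' fun i => by rw [hJΦ, sub_eq_zero]
  have hgen : ∀ x : Q, Function.Injective (generator E V F x) := fun x =>
    Function.LeftInverse.injective (A.form_generator x)
  refine ⟨⟨Φ, fun _ => rfl⟩, ?_, hinv, hinv₀, ?_, ?_, fun S S₀ => ⟨?_, ?_, ?_⟩⟩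
  · have h := pullbackForm_subCovector_canonicalForm hβ
    rw [hdβ] at h
    exact h
  · rw [show L = {α | ∀ i, gaugeMomentum (η i) α = c i} from Set.ext hmem]
    exact nonempty_submanifoldStructure_gaugeLevel A hη_smooth hμ c
  · rw [show L₀ = {α | ∀ i, gaugeMomentum (η i) α = 0} from Set.ext hmem₀]
    exact nonempty_submanifoldStructure_gaugeLevel A hη_smooth hμ fun _ => 0
  · exact nonempty_quotientManifoldStructure_orbitSetoid hfree hgen hinv S
  · exact nonempty_quotientManifoldStructure_orbitSetoid hfree hgen hinv₀ S₀
  · refine ⟨S.diffeomorph S₀ Φ hΦL, fun _ => rfl, fun h α _ => hequi h α, fun T T₀ => ?_⟩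
    -- By equivariance and injectivity of Φ the same group element relates two points and their
    -- images.
    refine exists_diffeomorph_quotient _ (fun α β => exists_congr fun h => ?_) T T₀
    change cotangentLift h α.1 = β.1 ↔ cotangentLift h (Φ α.1) = Φ β.1
    rw [← hequi]
    exact Φ.injective.eq_iff.symm
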